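/- **Theorem 15.3.** Assume $\mathbf V=\mathbf L$ (that is, argue in the constructible universe). If $k\ge 2$ and $\varphi$ is an $\mathcal L\Sigma^1_k$ formula, then $\mathbf{Forc}(\varphi)$ belongs to $\Sigma_{k-1}(\mathbf H_{\omega_2})$; if $\varphi$ is an $\mathcal L\Pi^1_k$ formula, then $\mathbf{Forc}(\varphi)$ belongs to $\Pi_{k-1}(\mathbf H_{\omega_2})$. Here the notions are as follows. * $\mathbf H_{\omega_2}$ is the set of all sets whose transitive closure has cardinality $<\aleph_2$. A relation on $\mathbf H_{\omega_2}$ is in $\Sigma_m(\mathbf H_{\omega_2})$ (resp. $\Pi_m(\mathbf H_{\omega_2})$) if it is definable in $\langle\mathbf H_{\omega_2},\in\rangle$ by a $\Sigma_m$ (resp. $\Pi_m$) formula of the Levy hierarchy with parameters in $\mathbf H_{\omega_2}$; for $m=0$ (bounded formulas) the class is called $\Delta_0(\mathbf H_{\omega_2})$. * A tree is a set $T\subseteq\omega_1^{<\omega}$ closed under initial segments; $\mathrm{succ}_T(s)$ is the set of extensions of $s$ in $T$ by exactly one term, and $s\in T$ is a branching node if $\mathrm{succ}_T(s)$ has at least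 two elements. $\mathbf{WT}$ is the set of all nonempty trees $T$ in which every $s\in T$ extends to a branching node and every branching node $t$ has $\mathrm{card}(\mathrm{succ}_T(t))=\aleph_1$. Further, $[T]=\{x\in\omega_1^\omega:\forall m\,(x\restriction m\in T)\}$. * For an ordinal $\vartheta$, $\mathbf{CCF}_\vartheta$ is the set of all maps $\mathbf c:\mathrm{dom}\,\mathbf c\to\vartheta$ with $\mathrm{dom}\,\mathbf c\subseteq\omega_1^{<\omega}\times\omega$ such that, for every $n$, strings $u,v$ with $\mathbf c(u,n)\ne\mathbf c(v,n)$ are incompatible, and for every $x\in\omega_1^\omega$ there is $m$ with $\langle x\restriction m,n\rangle\in\mathrm{dom}\,\mathbf c$. Such a code defines a continuous $f_{\mathbf c}:\omega_1^\omega\to\vartheta^\omega$, where $f_{\mathbf c}(x)(n)$ is the unique $\xi$ with $\mathbf c(x\restriction m,n)=\xi$ for some $m$. * Put $\Theta=\omega_2$. The $\mathcal L\Sigma^1_2$ formulas are $$\varphi(p_1,\dots,p_n):=\exists\chi\in\Theta^\omega\,\exists q\in\omega^\omega\,\forall m\;Q(\chi\restriction m,q\restriction m,p_1\restriction m,\dots,p_n\restriction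 m),$$ with $n\ge0$ free variables $p_i$ over $\omega^\omega$, where $Q\subseteq\Theta^{<\omega}\times(\omega^{<\omega})^{n+1}$ is a $\Delta_0(\mathbf H_{\omega_2})$ set. The $\mathcal L\Pi^1_2$ formulas are those of the form $\forall\chi\,\forall q\,\exists m\,Q(\dots)$ with the same specifications. For $k\ge2$, $\mathcal L\Sigma^1_{k+1}$ formulas are $\exists q\,\psi$ with $\psi$ in $\mathcal L\Pi^1_k$, and $\mathcal L\Pi^1_{k+1}$ formulas are $\forall q\,\psi$ with $\psi$ in $\mathcal L\Sigma^1_k$, where $q$ ranges over $\omega^\omega$. $\varphi^-$ is the canonical transformation of $\neg\varphi$ to the dual form (quantifiers are switched, and $Q$ is replaced by its complement in $\Theta^{<\omega}\times(\omega^{<\omega})^{n+1}$). * For $T\in\mathbf{WT}$ and a formula whose free variables are replaced by codes in $\mathbf{CCF}_\omega$, the relation $T\ \mathbf{forc}\ \varphi$ is defined by induction: (A) if $\varphi(\mathbf c_1,\dots,\mathbf c_n)$ is $\mathcal L\Sigma^1_2$ as above, then $T\ \mathbf{forc}\ \varphi$ iff there are $\mathbf c\in\mathbf{CCF}_\omega$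 and $\mathbf d\in\mathbf{CCF}_\Theta$ such that $\forall m\;Q(f_{\mathbf d}(x)\restriction m,f_{\mathbf c}(x)\restriction m,f_{\mathbf c_1}(x)\restriction m,\dots,f_{\mathbf c_n}(x)\restriction m)$ for all $x\in[T]$; (B) if $\varphi$ is $\mathcal L\Pi^1_k$, $k\ge2$, then $T\ \mathbf{forc}\ \varphi$ iff there is no $S\in\mathbf{WT}$ with $S\subseteq T$ and $S\ \mathbf{forc}\ \varphi^-$; (C) if $\varphi$ is $\exists q\,\psi(q)$ in $\mathcal L\Sigma^1_{k+1}$, with $\psi$ in $\mathcal L\Pi^1_k$, $k\ge2$, then $T\ \mathbf{forc}\ \varphi$ iff $T\ \mathbf{forc}\ \psi(\mathbf c)$ for some $\mathbf c\in\mathbf{CCF}_\omega$. * $\mathbf{Forc}(\varphi)=\{\langle T,\mathbf c_1,\dots,\mathbf c_n\rangle:T\in\mathbf{WT},\ \mathbf c_i\in\mathbf{CCF}_\omega,\ T\ \mathbf{forc}\ \varphi(\mathbf c_1,\dots,\mathbf c_n)\}$. -/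

import Mathlib

universe u

namespace WideTrees

/-! ## First-order formulas of set theory and the Levy hierarchy -/

/-- Formulas of the language `{∈, =}` whose free variables are among `x_0, …, x_{n-1}`.
The quantifier of `ex φ` binds the last variable of `φ`. -/
inductive SetFormula : ℕ → Type
  | eq {n : ℕ} (i j : Fin n) : SetFormula n
  | mem {n : ℕ} (i j : Fin n) : SetFormula n
  | neg {n : ℕ} (φ : SetFormula n) : SetFormula n
  | and {n : ℕ} (φ ψ : SetFormula n) : SetFormula n
  | ex {n : ℕ} (φ : SetFormula (n + 1)) : SetFormula n

/-- Truth of a formula in the structure `⟨A, ∈⟩`, under the assignment `v`. -/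
def Sat (A : Set ZFSet.{u}) : {n : ℕ} → SetFormula n → (Fin n → ZFSet.{u}) → Prop
  | _, .eq i j, v => v i = v j
  | _, .mem i j, v => v i ∈ v j
  | _, .neg φ, v => ¬ Sat A φ v
  | _, .and φ ψ, v => Sat A φ v ∧ Sat A ψ v
  | n, .ex φ, v => ∃ a ∈ A, Sat A φ (Fin.snoc v a : Fin (n + 1) → ZFSet.{u})

/-- Bounded (`Δ_0`) formulas: the only quantifiers are `∃ y ∈ x_i` (and `∀ y ∈ x_i`, through
negation). -/
inductive SetFormula.IsBounded : {n : ℕ} → SetFormula n → Prop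
  | eq {n : ℕ} (i j : Fin n) : IsBounded (.eq i j)
  | mem {n : ℕ} (i j : Fin n) : IsBounded (.mem i j)
  | neg {n : ℕ} {φ : SetFormula n} (h : IsBounded φ) : IsBounded φ.neg
  | and {n : ℕ} {φ ψ : SetFormula n} (h : IsBounded φ) (h' : IsBounded ψ) : IsBounded (φ.and ψ)
  | bex {n : ℕ} (i : Fin n) {φ : SetFormula (n + 1)} (h : IsBounded φ) :
      IsBounded (.ex ((SetFormula.mem (Fin.last n) i.castSucc).and φ))

/-- `SetFormula.IsLevy true k φ` says that `φ` is a `Σ_k` formula, and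
`SetFormula.IsLevy false k φ` that it is a `Π_k` formula. A `Σ_{k+1}` formula is a string of
quantifiers `∃` followed by a `Π_k` formula, a `Π_{k+1}` formula is a string of quantifiers `∀`
(written `¬ ∃ ¬`) followed by a `Σ_k` formula, and `Σ_0 = Π_0` are the bounded formulas. -/
inductive SetFormula.IsLevy : Bool → ℕ → {n : ℕ} → SetFormula n → Prop
  | bounded {b : Bool} {n : ℕ} {φ : SetFormula n} (h : φ.IsBounded) : IsLevy b 0 φ
  | ofPi {k n : ℕ} {φ : SetFormula n} (h : IsLevy false k φ) : IsLevy true (k + 1) φ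
  | ex {k n : ℕ} {φ : SetFormula (n + 1)} (h : IsLevy true (k + 1) φ) :
      IsLevy true (k + 1) φ.ex
  | ofSigma {k n : ℕ} {φ : SetFormula n} (h : IsLevy true k φ) : IsLevy false (k + 1) φ
  | all {k n : ℕ} {φ : SetFormula (n + 1)} (h : IsLevy false (k + 1) φ) :
      IsLevy false (k + 1) φ.neg.ex.neg

/-- The `n`-ary relation on `A` defined in `⟨A, ∈⟩` by the formula `φ` with parameters `p`. -/
def definedRel (A : Set ZFSet.{u}) {n r : ℕ} (φ : SetFormula (n + r)) (p : Fin r → ZFSet.{u}) :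
    Set (Fin n → ZFSet.{u}) :=
  {v | (∀ i, v i ∈ A) ∧ Sat A φ (Fin.append v p)}

/-- `X` is in the class `Σ_k(A)`: it is a relation on `A` definable in `⟨A, ∈⟩` by a `Σ_k` formula
with parameters in `A`. -/
def IsSigma (A : Set ZFSet.{u}) (k : ℕ) {n : ℕ} (X : Set (Fin n → ZFSet.{u})) : Prop :=
  ∃ (r : ℕ) (φ : SetFormula (n + r)) (p : Fin r → ZFSet.{u}),
    φ.IsLevy true k ∧ (∀ i, p i ∈ A) ∧ X = definedRel A φ p

/-- `X` is in the class `Π_k(A)`: it is a relation on `A` definable in `⟨A, ∈⟩` by a `Π_k` formula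
with parameters in `A`. -/
def IsPi (A : Set ZFSet.{u}) (k : ℕ) {n : ℕ} (X : Set (Fin n → ZFSet.{u})) : Prop :=
  ∃ (r : ℕ) (φ : SetFormula (n + r)) (p : Fin r → ZFSet.{u}),
    φ.IsLevy false k ∧ (∀ i, p i ∈ A) ∧ X = definedRel A φ p

/-! ## The constructible hierarchy -/

/-- `Def(A)`: the set of all subsets of `A` that are definable in `⟨A, ∈⟩` with parameters. -/
noncomputable def defPowerset (A : ZFSet.{u}) : ZFSet.{u} :=
  ZFSet.sep (fun x => ∃ (r : ℕ) (φ : SetFormula (1 + r)) (p : Fin r → ZFSet.{u}),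
      (∀ i, p i ∈ A) ∧
        x = ZFSet.sep (fun y => Sat {z | z ∈ A} φ (Fin.append (fun _ : Fin 1 => y) p)) A)
    (ZFSet.powerset A)

/-- The levels `L_α = ⋃_{β < α} Def(L_β)` of the constructible hierarchy. -/
noncomputable def constructibleLevel (α : Ordinal.{u}) : ZFSet.{u} :=
  ZFSet.iUnion fun β : Set.Iio α => defPowerset (constructibleLevel β.1)
termination_by α
decreasing_by exact β.2

/-- The axiom of constructibility `V = L`, for the universe of sets `ZFSet`. -/
def VEqualsL : Prop :=
  ∀ x : ZFSet.{u}, ∃ α : Ordinal.{u}, x ∈ constructibleLevel α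

/-! ## Sets of hereditary cardinality at most `ℵ_1` -/

/-- The transitive closure of `x`: the least transitive set that includes `x`. -/
noncomputable def transClosure (x : ZFSet.{u}) : ZFSet.{u} :=
  ZFSet.sep (fun y => ∀ t : ZFSet.{u}, t.IsTransitive → x ⊆ t → y ∈ t)
    (ZFSet.vonNeumann x.rank)

/-- `H_{ω_2}`: all sets whose transitive closure has cardinality less than `ℵ_2`. -/
def Homega2 : Set ZFSet.{u} :=
  {x | (transClosure x).card < Cardinal.aleph 2}

/-! ## Strings and wide trees -/

/-- `ω_1`, as a von Neumann ordinal. -/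
noncomputable def omegaOne : ZFSet.{u} := (Ordinal.omega 1).toZFSet

/-- `Θ = ω_2`, as a von Neumann ordinal. -/
noncomputable def Θ : ZFSet.{u} := (Ordinal.omega 2).toZFSet

/-- `s ∈ A^{<ω}`: `s` is a function from some natural number into `A`. For strings `s, t`, the
inclusion `s ⊆ t` of sets says that `t` extends `s`. -/
def IsString (A s : ZFSet.{u}) : Prop :=
  ∃ n ∈ ZFSet.omega.{u}, ZFSet.IsFunc n A s

/-- The restriction `x ↾ m` of a function `x` to `m`. -/
noncomputable def restr (x m : ZFSet.{u}) : ZFSet.{u} :=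
  ZFSet.sep (fun p => ∃ i ∈ m, ∃ y, p = ZFSet.pair i y) x

/-- `T` is a tree: a set of strings of countable ordinals closed under initial segments. -/
def IsTree (T : ZFSet.{u}) : Prop :=
  (∀ s ∈ T, IsString omegaOne s) ∧ ∀ s ∈ T, ∀ t, IsString omegaOne t → t ⊆ s → t ∈ T

/-- `succ_T(s)`: the set of all `t ∈ T` that extend `s` by exactly one term. -/
noncomputable def treeSucc (T s : ZFSet.{u}) : ZFSet.{u} :=
  ZFSet.sep (fun t => s ⊆ t ∧ ∃ n ∈ ZFSet.omega.{u},
    ZFSet.IsFunc n omegaOne s ∧ ZFSet.IsFunc (insert n n) omegaOne t) T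

/-- `s ∈ BN(T)`: `s` is a branching node of `T`. -/
def IsBranchingNode (T s : ZFSet.{u}) : Prop :=
  s ∈ T ∧ 2 ≤ (treeSucc T s).card

/-- The set `WT` of all wide trees: nonempty trees `T` in which every string extends to a branching
node, and in which every branching node has exactly `ℵ_1` successors. -/
def WT : Set ZFSet.{u} :=
  {T | IsTree T ∧ T.Nonempty ∧ (∀ s ∈ T, ∃ t, IsBranchingNode T t ∧ s ⊆ t) ∧
    ∀ t, IsBranchingNode T t → (treeSucc T t).card = Cardinal.aleph 1}

/-- `x ∈ [T]`: `x ∈ ω_1^ω`, and all restrictions of `x` to natural numbers belong to `T`. -/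
def IsBranch (T x : ZFSet.{u}) : Prop :=
  ZFSet.IsFunc ZFSet.omega omegaOne x ∧ ∀ m ∈ ZFSet.omega.{u}, restr x m ∈ T

/-! ## Codes of continuous functions -/

/-- `CCF_ϑ`: the set of all codes of continuous functions from `ω_1^ω` to `ϑ^ω`. A code is a map `c`
with `dom c ⊆ ω_1^{<ω} × ω` and values in `ϑ`, such that for every `n`: strings `u`, `v` with
different values `c(u, n) ≠ c(v, n)` are incompatible, and every `x ∈ ω_1^ω` has a restriction
`x ↾ m` with `⟨x ↾ m, n⟩ ∈ dom c`. -/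
def CCF (ϑ : ZFSet.{u}) : Set ZFSet.{u} :=
  {c | (∀ p ∈ c, ∃ s n ξ, IsString omegaOne s ∧ n ∈ ZFSet.omega.{u} ∧ ξ ∈ ϑ ∧
          p = ZFSet.pair (ZFSet.pair s n) ξ) ∧
    (∀ a ξ η, ZFSet.pair a ξ ∈ c → ZFSet.pair a η ∈ c → ξ = η) ∧
    (∀ n ∈ ZFSet.omega.{u}, ∀ ξ η, ξ ≠ η → ∀ s t,
      ZFSet.pair (ZFSet.pair s n) ξ ∈ c → ZFSet.pair (ZFSet.pair t n) η ∈ c →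
        ¬ (s ⊆ t ∨ t ⊆ s)) ∧
    (∀ n ∈ ZFSet.omega.{u}, ∀ x, ZFSet.IsFunc ZFSet.omega omegaOne x →
      ∃ m ∈ ZFSet.omega.{u}, ∃ ξ, ZFSet.pair (ZFSet.pair (restr x m) n) ξ ∈ c)}

/-- The value `f_c(x) ∈ ϑ^ω`, for a code `c ∈ CCF_ϑ` and `x ∈ ω_1^ω`: `f_c(x)(n)` is the unique `ξ`
such that `c(x ↾ m, n) = ξ` for some `m`. -/
noncomputable def codeFun (ϑ c x : ZFSet.{u}) : ZFSet.{u} :=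
  ZFSet.sep (fun p => ∃ n ξ, p = ZFSet.pair n ξ ∧
      ∃ m ∈ ZFSet.omega.{u}, ZFSet.pair (ZFSet.pair (restr x m) n) ξ ∈ c)
    (ZFSet.prod ZFSet.omega ϑ)

/-! ## The formulas of `𝓛` -/

/-- The formulas with `n` free variables over `ω^ω`: prefixes of quantifiers over `ω^ω` in front of
an elementary formula given by its matrix `Q`. The index `b` is `true` for the type `𝓛Σ^1_k` and
`false` for the type `𝓛Π^1_k`.

* `sigma2 Q` is `∃ χ ∈ Θ^ω ∃ q ∈ ω^ω ∀ m Q(χ ↾ m, q ↾ m, p_1 ↾ m, …, p_n ↾ m)`;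
* `pi2 Q` is `∀ χ ∈ Θ^ω ∀ q ∈ ω^ω ∃ m Q(χ ↾ m, q ↾ m, p_1 ↾ m, …, p_n ↾ m)`;
* `ex ψ` is `∃ q ∈ ω^ω ψ(q, p_1, …, p_n)`, and `all ψ` is `∀ q ∈ ω^ω ψ(q, p_1, …, p_n)`.

The requirement on the matrix is `LFormula.IsLegal` below. -/
inductive LFormula : Bool → ℕ → ℕ → Type (u + 1)
  | sigma2 {n : ℕ} (Q : Set (Fin (n + 2) → ZFSet.{u})) : LFormula true 2 n
  | pi2 {n : ℕ} (Q : Set (Fin (n + 2) → ZFSet.{u})) : LFormula false 2 n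
  | ex {k n : ℕ} (ψ : LFormula false k (n + 1)) : LFormula true (k + 1) n
  | all {k n : ℕ} (ψ : LFormula true k (n + 1)) : LFormula false (k + 1) n

/-- The product `Θ^{<ω} × (ω^{<ω})^{n+1}`. -/
def stringTuples (n : ℕ) : Set (Fin (n + 2) → ZFSet.{u}) :=
  {v | IsString Θ (v 0) ∧ ∀ i : Fin (n + 1), IsString ZFSet.omega (v i.succ)}

/-- `φ` is a formula of `𝓛`: its matrix `Q` is a subset of `Θ^{<ω} × (ω^{<ω})^{n+1}` in the class
`Δ_0(H_{ω_2})`. -/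
def LFormula.IsLegal : {b : Bool} → {k n : ℕ} → LFormula.{u} b k n → Prop
  | _, _, n, .sigma2 Q => Q ⊆ stringTuples n ∧ IsSigma Homega2 0 Q
  | _, _, n, .pi2 Q => Q ⊆ stringTuples n ∧ IsSigma Homega2 0 Q
  | _, _, _, .ex ψ => ψ.IsLegal
  | _, _, _, .all ψ => ψ.IsLegal

/-- The canonical transformation `φ ↦ φ⁻` of the negation of `φ` to the dual form. -/
def LFormula.dual : {b : Bool} → {k n : ℕ} → LFormula.{u} b k n → LFormula.{u} (!b) k n
  | _, _, n, .sigma2 Q => .pi2 (stringTuples n \ Q)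
  | _, _, n, .pi2 Q => .sigma2 (stringTuples n \ Q)
  | _, _, _, .ex ψ => .all ψ.dual
  | _, _, _, .all ψ => .ex ψ.dual

/-! ## The relation `forc` -/

/-- `T forc φ(c_1, …, c_n)`, for a tree `T ∈ WT` and codes `c_i ∈ CCF_ω`. -/
def Forces : {b : Bool} → {k n : ℕ} →
    LFormula.{u} b k n → ZFSet.{u} → (Fin n → ZFSet.{u}) → Prop
  | _, _, n, .sigma2 Q, T, cs =>
      ∃ c ∈ CCF ZFSet.omega.{u}, ∃ d ∈ CCF Θ.{u}, ∀ x, IsBranch T x → ∀ m ∈ ZFSet.omega.{u},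
        (Fin.cons (restr (codeFun Θ d x) m)
          (Fin.cons (restr (codeFun ZFSet.omega c x) m)
            (fun i => restr (codeFun ZFSet.omega (cs i) x) m) : Fin (n + 1) → ZFSet.{u}) :
          Fin (n + 2) → ZFSet.{u}) ∈ Q
  | _, _, _, .pi2 Q, T, cs => ¬ ∃ S ∈ WT.{u}, S ⊆ T ∧ Forces (LFormula.pi2 Q).dual S cs
  | _, _, n, .ex ψ, T, cs =>
      ∃ c ∈ CCF ZFSet.omega.{u}, Forces ψ T (Fin.cons c cs : Fin (n + 1) → ZFSet.{u})
  | _, _, _, .all ψ, T, cs => ¬ ∃ S ∈ WT.{u}, S ⊆ T ∧ Forces (LFormula.all ψ).dual S cs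
termination_by b k => 2 * k + (if b then 0 else 1)

/-- `Forc(φ)`: the set of all tuples `⟨T, c_1, …, c_n⟩` with `T ∈ WT`, `c_i ∈ CCF_ω` and
`T forc φ(c_1, …, c_n)`. -/
def Forc {b : Bool} {k n : ℕ} (φ : LFormula.{u} b k n) : Set (Fin (n + 1) → ZFSet.{u}) :=
  {v | v 0 ∈ WT ∧ (∀ i : Fin n, v i.succ ∈ CCF ZFSet.omega) ∧
    Forces φ (v 0) (fun i => v i.succ)}

end WideTrees

universe v

namespace WideTrees
open Cardinal

/-! All objects involved live in `H_{ω_2}`. A wide tree is a subset of the set `Str` of strings of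
countable ordinals, which has at most `ℵ_1` elements; a code, even with values in `ω_2`, is in
effect a partial function on `Str × ω`. So the quantifiers over `WT` and `CCF` in the definition of
forcing are quantifiers over `H_{ω_2}`, and what remains is to measure the complexity of the notions
under them, with `ω`, `ω_1` and `Str` as parameters.

Being a wide tree is bounded (`mem_WT_iff`): by regularity of `ω_1`, a node has `ℵ_1` successors iff
their last terms are unbounded in `ω_1`. Being a code is `Δ_1` (`Lev.mem_CCF`). It is `Π_1` because
sequences in `ω_1^ω` belong to `H_{ω_2}`. It is `Σ_1` because every sequence meets the domain of the
code at `i` iff the strings not deciding the value at `i` are well-founded under proper extension,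
and this is witnessed by a ranking (`mem_CCF_iff_exists_isRanking`).

The quantifier over branches in the base case is removed by `forall_isBranch_iff`: the values below
`m` on a branch are decided by a finite segment of it, and each node of a wide tree lies on a
branch, so it suffices to look at the nodes `s ∈ T` and the values that they decide. With one more
existential quantifier, over a set `D` holding the decided strings, the condition is bounded, so
forcing of `𝓛Σ^1_2` formulas is `Σ_1`.

The rest is induction (`Lev.forc`). Passing from `𝓛Σ^1_k` to `𝓛Π^1_k` negates an existential
quantifier that the `Σ_{k-1}` class absorbs; passing from `𝓛Π^1_k` to `𝓛Σ^1_{k+1}` puts an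
existential quantifier in front of a `Π_{k-1}` relation. -/

/-! ### Closure properties of `H_{ω_2}`. -/

theorem isTransitive_transClosure (x : ZFSet.{u}) : (transClosure x).IsTransitive := by
  intro y hy z hz
  simp only [transClosure, ZFSet.mem_sep] at hy ⊢
  exact ⟨(ZFSet.isTransitive_vonNeumann _).subset_of_mem hy.1 hz,
    fun t ht hx => ht.subset_of_mem (hy.2 t ht hx) hz⟩

theorem subset_transClosure (x : ZFSet.{u}) : x ⊆ transClosure x := by
  intro y hy
  simp only [transClosure, ZFSet.mem_sep]
  exact ⟨ZFSet.subset_vonNeumann_self x hy, fun t _ hx => hx hy⟩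

theorem transClosure_subset {x t : ZFSet.{u}} (ht : t.IsTransitive) (h : x ⊆ t) :
    transClosure x ⊆ t := fun _ hy => (ZFSet.mem_sep.1 hy).2 t ht h

theorem transClosure_mono {x y : ZFSet.{u}} (h : x ⊆ transClosure y) :
    transClosure x ⊆ transClosure y :=
  transClosure_subset (isTransitive_transClosure y) h

theorem mem_Homega2 {x : ZFSet.{u}} : x ∈ Homega2 ↔ (transClosure x).card < ℵ_ 2 := Iff.rfl

theorem mem_Homega2_of_mem {x y : ZFSet.{u}} (hx : x ∈ Homega2) (hy : y ∈ x) : y ∈ Homega2 :=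
  (ZFSet.card_mono (transClosure_mono
    ((isTransitive_transClosure x).subset_of_mem (subset_transClosure x hy)))).trans_lt hx

theorem mem_Homega2_of_subset {x y : ZFSet.{u}} (hx : x ∈ Homega2) (hy : y ⊆ x) : y ∈ Homega2 :=
  (ZFSet.card_mono (transClosure_mono (fun _ h => subset_transClosure x (hy h)))).trans_lt hx

theorem card_lt_of_mem_Homega2 {x : ZFSet.{u}} (hx : x ∈ Homega2) : x.card < ℵ_ 2 :=
  (ZFSet.card_mono (subset_transClosure x)).trans_lt hx

theorem lt_aleph_two_iff {c : Cardinal.{u}} : c < ℵ_ 2 ↔ c ≤ ℵ_ 1 := by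
  have : (2 : Ordinal.{u}) = 1 + 1 := by norm_num
  rw [this, ← Cardinal.succ_aleph, Order.lt_succ_iff]

/-- The union of `x` with the transitive closures of its elements is transitive, and is made of at
most `ℵ_1` sets of size at most `ℵ_1`. -/
theorem mem_Homega2_of_card {x : ZFSet.{u}} (hx : x.card < ℵ_ 2) (h : ∀ y ∈ x, y ∈ Homega2) :
    x ∈ Homega2 := by
  set U : ZFSet.{u} := ZFSet.iUnion (fun y : x => transClosure y.1) with hU
  have ht : (x ∪ U).IsTransitive := by
    intro y hy z hz
    rw [ZFSet.mem_union] at hy ⊢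
    right
    rcases hy with hy | hy
    · exact ZFSet.mem_iUnion.2 ⟨⟨y, hy⟩, subset_transClosure y hz⟩
    · obtain ⟨w, hw⟩ := ZFSet.mem_iUnion.1 hy
      exact ZFSet.mem_iUnion.2 ⟨w, (isTransitive_transClosure _).subset_of_mem hw hz⟩
  have hsub : transClosure x ⊆ x ∪ U :=
    transClosure_subset ht (fun y hy => ZFSet.mem_union.2 (Or.inl hy))
  rw [mem_Homega2, lt_aleph_two_iff]
  rw [lt_aleph_two_iff] at hx
  refine (ZFSet.card_mono hsub).trans (ZFSet.card_union_le.trans ?_)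
  refine Cardinal.add_le_of_le (aleph0_le_aleph 1) hx ?_
  have h1 := ZFSet.lift_card_iUnion_le_sum_card (f := fun y : x => transClosure y.1)
  rw [← hU] at h1
  have h2 : (Cardinal.sum fun y : x => (transClosure y.1).card) ≤
      Cardinal.sum fun _ : x => ℵ_ 1 :=
    Cardinal.sum_le_sum _ _ fun y => lt_aleph_two_iff.1 (h y.1 y.2)
  have h3 := h1.trans h2
  rw [Cardinal.sum_const, ZFSet.cardinalMk_coe_sort] at h3
  have h4 : lift.{u + 1, u} U.card ≤ lift.{u + 1, u} (ℵ_ 1) := by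
    refine le_trans (by simpa using h3) ?_
    have : lift.{u + 1, u} x.card ≤ lift.{u + 1, u} (ℵ_ 1) := lift_le.2 hx
    refine (mul_le_mul' this le_rfl).trans ?_
    simp
  exact lift_le.1 h4

theorem mem_Homega2_of_finite {x : ZFSet.{u}} (hx : x.card < ℵ₀) (h : ∀ y ∈ x, y ∈ Homega2) :
    x ∈ Homega2 :=
  mem_Homega2_of_card (hx.trans_le (aleph0_le_aleph 2)) h

theorem empty_mem_Homega2 : (∅ : ZFSet.{u}) ∈ Homega2 :=
  mem_Homega2_of_finite (by simpa using aleph0_pos) (by simp)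

theorem insert_mem_Homega2 {x y : ZFSet.{u}} (hx : x ∈ Homega2) (hy : y ∈ Homega2) :
    insert x y ∈ Homega2 := by
  refine mem_Homega2_of_card (ZFSet.card_insert_le.trans_lt ?_) ?_
  · exact add_lt_of_lt (aleph0_le_aleph 2) (card_lt_of_mem_Homega2 hy)
      (one_lt_aleph0.trans_le (aleph0_le_aleph 2))
  · intro z hz
    rcases ZFSet.mem_insert_iff.1 hz with rfl | hz
    · exact hx
    · exact mem_Homega2_of_mem hy hz

theorem singleton_mem_Homega2 {x : ZFSet.{u}} (hx : x ∈ Homega2) : {x} ∈ Homega2 := by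
  simpa using! insert_mem_Homega2 hx empty_mem_Homega2

theorem pair_mem_Homega2 {x y : ZFSet.{u}} (hx : x ∈ Homega2) (hy : y ∈ Homega2) :
    ZFSet.pair x y ∈ Homega2 :=
  insert_mem_Homega2 (singleton_mem_Homega2 hx)
    (singleton_mem_Homega2 (insert_mem_Homega2 hx (singleton_mem_Homega2 hy)))

theorem transClosure_mem_Homega2 {x : ZFSet.{u}} (hx : x ∈ Homega2) :
    transClosure x ∈ Homega2 :=
  (ZFSet.card_mono (transClosure_subset (isTransitive_transClosure x) (fun _ h => h))).trans_lt hx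

theorem range_mem_Homega2 {α : Type u} {f : α → ZFSet.{u}} (hα : #α < ℵ_ 2)
    (h : ∀ a, f a ∈ Homega2) : ZFSet.range f ∈ Homega2 := by
  refine mem_Homega2_of_card (lt_of_le_of_lt ?_ hα) ?_
  · simpa using ZFSet.lift_card_range_le (f := f)
  · intro y hy
    obtain ⟨a, rfl⟩ := ZFSet.mem_range.1 hy
    exact h a

theorem toZFSet_mem_Homega2 {o : Ordinal.{u}} : o.toZFSet ∈ Homega2 ↔ o < Ordinal.omega 2 := by
  have hcard : o.card < ℵ_ 2 ↔ o < Ordinal.omega 2 := by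
    rw [← Cardinal.ord_aleph, Cardinal.lt_ord]
  rw [← hcard, ← Ordinal.card_toZFSet]
  refine ⟨card_lt_of_mem_Homega2, fun h => lt_of_le_of_lt (ZFSet.card_mono ?_) h⟩
  exact transClosure_subset (ZFSet.isOrdinal_toZFSet o).isTransitive (fun _ h => h)

/-- `Θ` is not an element of `H_{ω_2}` and cannot serve as a parameter. Inside `H_{ω_2}` it is the
class of all ordinals, which has a bounded definition. -/
theorem mem_Theta {x : ZFSet.{u}} : x ∈ Θ ↔ x.IsOrdinal ∧ x ∈ Homega2 := by
  constructor
  · intro h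
    obtain ⟨a, ha, rfl⟩ := Ordinal.mem_toZFSet_iff.1 h
    exact ⟨ZFSet.isOrdinal_toZFSet a, toZFSet_mem_Homega2.2 ha⟩
  · rintro ⟨h, h'⟩
    rw [← h.toZFSet_rank_eq] at h' ⊢
    exact Ordinal.mem_toZFSet_iff.2 ⟨_, toZFSet_mem_Homega2.1 h', rfl⟩

theorem omegaOne_mem_Homega2 : omegaOne.{u} ∈ Homega2 :=
  toZFSet_mem_Homega2.2 (Ordinal.omega_lt_omega.2 (by norm_num))

/-! ### Natural numbers and `ω` as sets. -/

/-- The natural number `n` as a von Neumann ordinal. -/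
noncomputable def nat (n : ℕ) : ZFSet.{u} := (n : Ordinal.{u}).toZFSet

theorem nat_succ (n : ℕ) : nat.{u} (n + 1) = insert (nat n) (nat n) := by
  simp [nat, Ordinal.toZFSet_add_one]

theorem nat_mem_nat {i n : ℕ} : nat.{u} i ∈ nat n ↔ i < n := by
  simp [nat, Ordinal.toZFSet_mem_toZFSet_iff]

theorem nat_injective : Function.Injective nat.{u} := fun a b h => by
  simpa [nat] using! Ordinal.toZFSet_injective h

theorem mem_nat {x : ZFSet.{u}} {n : ℕ} : x ∈ nat n ↔ ∃ i < n, x = nat i := by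
  constructor
  · intro h
    obtain ⟨a, ha, rfl⟩ := Ordinal.mem_toZFSet_iff.1 h
    obtain ⟨i, rfl⟩ := Ordinal.lt_omega0.1 (ha.trans (Ordinal.natCast_lt_omega0 n))
    exact ⟨i, by simpa using ha, rfl⟩
  · rintro ⟨i, hi, rfl⟩
    exact nat_mem_nat.2 hi

theorem mem_omega {x : ZFSet.{u}} : x ∈ ZFSet.omega ↔ ∃ n, x = nat n := by
  have key : ∀ n : ℕ, ZFSet.mk (PSet.ofNat.{u} n) = nat n := by
    intro n
    induction n with
    | zero => simp [nat]; rfl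
    | succ n ih => rw [nat_succ, ← ih]; rfl
  constructor
  · induction x using Quotient.inductionOn with | _ x => ?_
    rintro ⟨⟨n⟩, h⟩
    exact ⟨n, (ZFSet.sound h).trans (key n)⟩
  · rintro ⟨n, rfl⟩
    rw [← key]
    exact ⟨⟨n⟩, PSet.Equiv.rfl⟩

theorem nat_mem_omega (n : ℕ) : nat.{u} n ∈ ZFSet.omega := mem_omega.2 ⟨n, rfl⟩

theorem omega_eq : ZFSet.omega.{u} = Ordinal.omega0.toZFSet := by
  ext x
  rw [mem_omega, Ordinal.mem_toZFSet_iff]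
  constructor
  · rintro ⟨n, rfl⟩
    exact ⟨n, Ordinal.natCast_lt_omega0 n, rfl⟩
  · rintro ⟨a, ha, rfl⟩
    obtain ⟨n, rfl⟩ := Ordinal.lt_omega0.1 ha
    exact ⟨n, rfl⟩

theorem omega_mem_Homega2 : ZFSet.omega.{u} ∈ Homega2 := by
  rw [omega_eq, toZFSet_mem_Homega2, ← Ordinal.omega_zero]
  exact Ordinal.omega_lt_omega.2 (by norm_num)

theorem omega_subset_Theta : ZFSet.omega.{u} ⊆ Θ := by
  intro x hx
  obtain ⟨n, rfl⟩ := mem_omega.1 hx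
  exact mem_Theta.2 ⟨ZFSet.isOrdinal_toZFSet _, mem_Homega2_of_mem omega_mem_Homega2 hx⟩

/-! ### Closure of the Levy classes of formulas. -/

namespace SetFormula

/-- Renaming of the free variables of a formula. -/
def rename : {n m : ℕ} → (Fin n → Fin m) → SetFormula n → SetFormula m
  | _, _, f, .eq i j => .eq (f i) (f j)
  | _, _, f, .mem i j => .mem (f i) (f j)
  | _, _, f, .neg φ => .neg (rename f φ)
  | _, _, f, .and φ ψ => .and (rename f φ) (rename f ψ)
  | n, m, f, .ex φ => .ex (rename (Fin.snoc (fun i => (f i).castSucc) (Fin.last m) :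
      Fin (n + 1) → Fin (m + 1)) φ)

theorem snoc_comp_snoc {n m : ℕ} (f : Fin n → Fin m) (v : Fin m → ZFSet.{u}) (a : ZFSet.{u}) :
    (fun i => (Fin.snoc v a : Fin (m + 1) → ZFSet.{u})
      ((Fin.snoc (fun i => (f i).castSucc) (Fin.last m) : Fin (n + 1) → Fin (m + 1)) i)) =
    (Fin.snoc (fun i => v (f i)) a : Fin (n + 1) → ZFSet.{u}) := by
  funext i
  refine Fin.lastCases ?_ (fun i => ?_) i <;> simp

theorem sat_rename {A : Set ZFSet.{u}} {n m : ℕ} (f : Fin n → Fin m) (φ : SetFormula n)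
    (v : Fin m → ZFSet.{u}) : Sat A (rename f φ) v ↔ Sat A φ (fun i => v (f i)) := by
  induction φ generalizing m with
  | eq i j => rfl
  | mem i j => rfl
  | neg φ ih => exact not_congr (ih f v)
  | and φ ψ ih ih' => exact and_congr (ih f v) (ih' f v)
  | ex φ ih =>
    refine exists_congr fun a => and_congr Iff.rfl ?_
    rw [ih, snoc_comp_snoc]

theorem IsBounded.rename {n : ℕ} {φ : SetFormula n} (h : φ.IsBounded) :
    ∀ {m : ℕ} (f : Fin n → Fin m), (φ.rename f).IsBounded := by
  induction h with
  | eq i j => exact fun f => .eq _ _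
  | mem i j => exact fun f => .mem _ _
  | neg _ ih => exact fun f => .neg (ih f)
  | and _ _ ih ih' => exact fun f => .and (ih f) (ih' f)
  | bex i _ ih =>
    intro m f
    simp only [SetFormula.rename, Fin.snoc_last, Fin.snoc_castSucc]
    exact .bex (f i) (ih _)

theorem IsLevy.rename {b : Bool} {k n : ℕ} {φ : SetFormula n} (h : φ.IsLevy b k) :
    ∀ {m : ℕ} (f : Fin n → Fin m), (φ.rename f).IsLevy b k := by
  induction h with
  | bounded h => exact fun f => .bounded (h.rename f)
  | ofPi _ ih => exact fun f => .ofPi (ih f)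
  | ex _ ih => exact fun f => .ex (ih _)
  | ofSigma _ ih => exact fun f => .ofSigma (ih f)
  | all _ ih => exact fun f => .all (ih _)

theorem IsLevy.isBounded {b : Bool} {n : ℕ} {φ : SetFormula n} (h : φ.IsLevy b 0) :
    φ.IsBounded := by
  cases h; assumption

/-- The additional level is inserted at the bounded core; the quantifier prefix is carried along. -/
theorem IsLevy.succ {b : Bool} {k n : ℕ} {φ : SetFormula n} (h : φ.IsLevy b k) :
    φ.IsLevy b (k + 1) := by
  induction h with
  | @bounded b _ _ h =>
    cases b
    exacts [.ofSigma (.bounded h), .ofPi (.bounded h)]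
  | ofPi _ ih => exact .ofPi ih
  | ex _ ih => exact .ex ih
  | ofSigma _ ih => exact .ofSigma ih
  | all _ ih => exact .all ih

theorem IsLevy.exists_not {A : Set ZFSet.{u}} {b : Bool} {k n : ℕ} {φ : SetFormula n}
    (h : φ.IsLevy b k) :
    ∃ χ : SetFormula n, χ.IsLevy (!b) k ∧ ∀ v, Sat A χ v ↔ ¬ Sat A φ v := by
  induction h with
  | bounded h => exact ⟨_, .bounded h.neg, fun v => Iff.rfl⟩
  | ofPi _ ih => obtain ⟨χ, h, h'⟩ := ih; exact ⟨χ, .ofSigma h, h'⟩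
  | ofSigma _ ih => obtain ⟨χ, h, h'⟩ := ih; exact ⟨χ, .ofPi h, h'⟩
  | ex _ ih =>
    obtain ⟨χ, h, h'⟩ := ih
    refine ⟨_, .all h, fun v => ?_⟩
    simp [Sat, h']
  | all _ ih =>
    obtain ⟨χ, h, h'⟩ := ih
    refine ⟨_, .ex h, fun v => ?_⟩
    simp [Sat, h']

/-- Prenex form: at each level the quantifiers of `φ` are pulled out, then those of `ψ`, and the two
cores meet one level lower. The renaming `f` moves `φ` below the quantifiers of `ψ`. Nonemptiness of
`A` is needed to pull a universal quantifier over the other conjunct. -/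
theorem IsLevy.exists_and {A : Set ZFSet.{u}} (hA : A.Nonempty) {b : Bool} {k n : ℕ}
    {φ : SetFormula n} (h : φ.IsLevy b k) :
    ∀ {m : ℕ} (f : Fin n → Fin m) {ψ : SetFormula m}, ψ.IsLevy b k →
      ∃ χ : SetFormula m, χ.IsLevy b k ∧
        ∀ v, Sat A χ v ↔ (Sat A φ (fun i => v (f i)) ∧ Sat A ψ v) := by
  obtain ⟨e, he⟩ := hA
  induction h with
  | bounded h =>
    exact fun f ψ hψ => ⟨_, .bounded ((h.rename f).and hψ.isBounded), fun v =>
      and_congr (sat_rename f _ v) Iff.rfl⟩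
  | @ofPi k n φ h ih =>
    intro m f ψ hψ
    generalize hb : true = b at hψ
    generalize hl : k + 1 = l at hψ
    induction hψ with
    | bounded => cases hl
    | ofSigma => cases hb
    | all => cases hb
    | ofPi hψ =>
      cases hl
      obtain ⟨χ, h1, h2⟩ := ih f hψ
      exact ⟨χ, .ofPi h1, h2⟩
    | ex _ ih' =>
      obtain ⟨χ, h1, h2⟩ := ih' (fun i => (f i).castSucc) hb hl
      cases hl
      refine ⟨_, .ex h1, fun v => ?_⟩
      simp only [Sat, h2, Fin.snoc_castSucc]
      exact ⟨fun ⟨a, ha, h, h'⟩ => ⟨h, a, ha, h'⟩, fun ⟨h, a, ha, h'⟩ => ⟨a, ha, h, h'⟩⟩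
  | @ofSigma k n φ h ih =>
    intro m f ψ hψ
    generalize hb : false = b at hψ
    generalize hl : k + 1 = l at hψ
    induction hψ with
    | bounded => cases hl
    | ofPi => cases hb
    | ex => cases hb
    | ofSigma hψ =>
      cases hl
      obtain ⟨χ, h1, h2⟩ := ih f hψ
      exact ⟨χ, .ofSigma h1, h2⟩
    | all _ ih' =>
      obtain ⟨χ, h1, h2⟩ := ih' (fun i => (f i).castSucc) hb hl
      cases hl
      refine ⟨_, .all h1, fun v => ?_⟩
      simp only [Sat, h2, Fin.snoc_castSucc]
      push Not
      exact ⟨fun H => ⟨(H e he).1, fun a ha => (H a ha).2⟩, fun H a ha => ⟨H.1, H.2 a ha⟩⟩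
  | @ex k n φ h ih =>
    intro m f ψ hψ
    obtain ⟨χ, h1, h2⟩ := ih (Fin.snoc (fun i => (f i).castSucc) (Fin.last m) :
      Fin (n + 1) → Fin (m + 1)) (hψ.rename Fin.castSucc)
    refine ⟨_, .ex h1, fun v => ?_⟩
    simp only [Sat, h2, snoc_comp_snoc, sat_rename, Fin.snoc_castSucc]
    exact ⟨fun ⟨a, ha, h, h'⟩ => ⟨⟨a, ha, h⟩, h'⟩, fun ⟨⟨a, ha, h⟩, h'⟩ => ⟨a, ha, h, h'⟩⟩
  | @all k n φ h ih =>
    intro m f ψ hψ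
    obtain ⟨χ, h1, h2⟩ := ih (Fin.snoc (fun i => (f i).castSucc) (Fin.last m) :
      Fin (n + 1) → Fin (m + 1)) (hψ.rename Fin.castSucc)
    refine ⟨_, .all h1, fun v => ?_⟩
    simp only [Sat, h2, snoc_comp_snoc, sat_rename, Fin.snoc_castSucc]
    push Not
    exact ⟨fun H => ⟨fun a ha => (H a ha).1, (H e he).2⟩, fun H a ha => ⟨H.1 a ha, H.2⟩⟩

end SetFormula

/-! ### A calculus of relations definable over `H_{ω_2}` with parameters. -/

/-- Terms over a set `ι` of variables: variables and constants from `H_{ω_2}`. -/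
inductive Tm (ι : Type v) : Type (max v (u + 1))
  | var (i : ι) : Tm ι
  | const (a : ZFSet.{u}) (ha : a ∈ Homega2) : Tm ι

namespace Tm

variable {ι : Type*} {κ : Type*}

/-- The value of a term. -/
def ev : Tm.{u} ι → (ι → ZFSet.{u}) → ZFSet.{u}
  | var i, v => v i
  | const a _, _ => a

/-- Renaming of the variables of a term. -/
def map (f : ι → κ) : Tm.{u} ι → Tm.{u} κ
  | var i => var (f i)
  | const a ha => const a ha

theorem ev_comp (f : ι → κ) (t : Tm.{u} ι) (w : κ → ZFSet.{u}) :
    t.ev (fun i => w (f i)) = (t.map f).ev w := by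
  cases t <;> rfl

theorem ev_mem (t : Tm.{u} ι) {v : ι → ZFSet.{u}} (hv : ∀ i, v i ∈ Homega2) :
    t.ev v ∈ Homega2 := by
  cases t with
  | var i => exact hv i
  | const a ha => exact ha

/-- The part of a term that does not depend on the variable `none`. -/
def drop : Tm.{u} (Option ι) → Tm.{u} ι
  | var (some i) => var i
  -- Junk value: `ev_extend` consults `drop` only for terms other than `none`.
  | var none => const ∅ empty_mem_Homega2
  | const a ha => const a ha

/-- The term is the variable `none`. -/
def isNone : Tm.{u} (Option ι) → Bool
  | var none => true
  | _ => false

theorem ev_extend (t : Tm.{u} (Option ι)) (v : ι → ZFSet.{u}) (a : ZFSet.{u}) :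
    t.ev (fun o => o.elim a v) = if t.isNone then a else t.drop.ev v := by
  rcases t with (_ | i) | a <;> simp [ev, isNone, drop]

end Tm

/-- `P` is definable in `H_{ω_2}` by a bounded formula with parameters. -/
def D0 {ι : Type v} (P : (ι → ZFSet.{u}) → Prop) : Prop :=
  ∃ (m : ℕ) (ψ : SetFormula m) (t : Fin m → Tm.{u} ι), ψ.IsBounded ∧
    ∀ v, (∀ i, v i ∈ Homega2) → (Sat Homega2 ψ (fun j => (t j).ev v) ↔ P v)

/-- `P` is definable in `H_{ω_2}` by a `Σ_k` (for `b = true`) or `Π_k` (for `b = false`) formula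
with parameters. -/
def Lev (b : Bool) (k : ℕ) {ι : Type v} (P : (ι → ZFSet.{u}) → Prop) : Prop :=
  ∃ (m : ℕ) (ψ : SetFormula m) (t : Fin m → Tm.{u} ι), ψ.IsLevy b k ∧
    ∀ v, (∀ i, v i ∈ Homega2) → (Sat Homega2 ψ (fun j => (t j).ev v) ↔ P v)

section
variable {ι : Type*} {κ : Type*} {P Q : (ι → ZFSet.{u}) → Prop}

theorem D0.congr (hP : D0 P) (h : ∀ v, (∀ i, v i ∈ Homega2) → (P v ↔ Q v)) : D0 Q := by
  obtain ⟨m, ψ, t, hψ, H⟩ := hP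
  exact ⟨m, ψ, t, hψ, fun v hv => (H v hv).trans (h v hv)⟩

theorem Lev.congr {b : Bool} {k : ℕ} (hP : Lev b k P)
    (h : ∀ v, (∀ i, v i ∈ Homega2) → (P v ↔ Q v)) : Lev b k Q := by
  obtain ⟨m, ψ, t, hψ, H⟩ := hP
  exact ⟨m, ψ, t, hψ, fun v hv => (H v hv).trans (h v hv)⟩

theorem D0.lev {b : Bool} (hP : D0 P) : Lev b 0 P := by
  obtain ⟨m, ψ, t, hψ, H⟩ := hP
  exact ⟨m, ψ, t, .bounded hψ, H⟩

theorem Lev.d0 {b : Bool} (hP : Lev b 0 P) : D0 P := by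
  obtain ⟨m, ψ, t, hψ, H⟩ := hP
  exact ⟨m, ψ, t, hψ.isBounded, H⟩

theorem Lev.mono {b : Bool} {k l : ℕ} (hP : Lev b k P) (h : k ≤ l) : Lev b l P := by
  induction h with
  | refl => exact hP
  | step _ ih =>
    obtain ⟨m, ψ, t, hψ, H⟩ := ih
    exact ⟨m, ψ, t, hψ.succ, H⟩

theorem D0.lev_of {b : Bool} {k : ℕ} (hP : D0 P) : Lev b k P := hP.lev.mono (Nat.zero_le k)

theorem Lev.not {b : Bool} {k : ℕ} (hP : Lev b k P) : Lev (!b) k (fun v => ¬ P v) := by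
  obtain ⟨m, ψ, t, hψ, H⟩ := hP
  obtain ⟨χ, h, h'⟩ := hψ.exists_not (A := Homega2)
  exact ⟨m, χ, t, h, fun v hv => (h' _).trans (not_congr (H v hv))⟩

theorem Lev.and {b : Bool} {k : ℕ} (hP : Lev b k P) (hQ : Lev b k Q) :
    Lev b k (fun v => P v ∧ Q v) := by
  obtain ⟨m, ψ, t, hψ, H⟩ := hP
  obtain ⟨m', ψ', t', hψ', H'⟩ := hQ
  obtain ⟨χ, h, h'⟩ := hψ.exists_and (A := Homega2) ⟨_, empty_mem_Homega2⟩ (Fin.castAdd m')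
    (hψ'.rename (Fin.natAdd m))
  refine ⟨m + m', χ, Fin.append t t', h, fun v hv => (h' _).trans ?_⟩
  simp [SetFormula.sat_rename, H v hv, H' v hv]

theorem Lev.comp {b : Bool} {k : ℕ} (hP : Lev b k P) (f : ι → κ) :
    Lev b k (fun w : κ → ZFSet.{u} => P (fun i => w (f i))) := by
  obtain ⟨m, ψ, t, hψ, H⟩ := hP
  refine ⟨m, ψ, fun j => (t j).map f, hψ, fun v hv => ?_⟩
  refine Iff.trans ?_ (H _ (fun i => hv (f i)))
  simp [Tm.ev_comp]

/-- The bound variable is the new index `none`, written as the value of a term so that the rules for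
terms apply to the body. All slots of the formula filled with `none` are merged into the last
variable, which is then quantified. -/
theorem Lev.ex {k : ℕ} {P : (ι → ZFSet.{u}) → ZFSet.{u} → Prop}
    (h : Lev true (k + 1) (fun w : Option ι → ZFSet.{u} =>
      P (fun i => w (some i)) ((Tm.var none).ev w))) :
    Lev true (k + 1) (fun v => ∃ y ∈ Homega2, P v y) := by
  obtain ⟨m, ψ, t, hψ, H⟩ := h
  refine ⟨m, .ex (ψ.rename fun j => if (t j).isNone then Fin.last m else j.castSucc),
    fun j => (t j).drop, .ex (hψ.rename _), fun v hv => ?_⟩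
  refine exists_congr fun a => and_congr_right fun ha => ?_
  rw [SetFormula.sat_rename]
  refine Iff.trans ?_ (H (fun o => o.elim a v) (fun o => ?_))
  · refine iff_of_eq (congrArg _ (funext fun j => ?_))
    rw [Tm.ev_extend]
    split_ifs <;> simp
  · cases o
    exacts [ha, hv _]

theorem Lev.all {k : ℕ} {P : (ι → ZFSet.{u}) → ZFSet.{u} → Prop}
    (h : Lev false (k + 1) (fun w : Option ι → ZFSet.{u} =>
      P (fun i => w (some i)) ((Tm.var none).ev w))) :
    Lev false (k + 1) (fun v => ∀ y ∈ Homega2, P v y) := by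
  have h1 := (Lev.ex (P := fun v y => ¬ P v y) h.not).not
  refine h1.congr fun v _ => ?_
  push Not
  rfl

theorem D0.comp (hP : D0 P) (f : ι → κ) :
    D0 (fun w : κ → ZFSet.{u} => P (fun i => w (f i))) :=
  ((hP.lev (b := true)).comp f).d0

theorem D0.not (hP : D0 P) : D0 (fun v => ¬ P v) := ((hP.lev (b := true)).not).d0

theorem D0.and (hP : D0 P) (hQ : D0 Q) : D0 (fun v => P v ∧ Q v) :=
  ((hP.lev (b := true)).and hQ.lev).d0

theorem D0.or (hP : D0 P) (hQ : D0 Q) : D0 (fun v => P v ∨ Q v) :=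
  (hP.not.and hQ.not).not.congr fun v _ => by tauto

theorem D0.imp (hP : D0 P) (hQ : D0 Q) : D0 (fun v => P v → Q v) :=
  (hP.and hQ.not).not.congr fun v _ => by tauto

theorem D0.eq (s t : Tm.{u} ι) : D0 (fun v => s.ev v = t.ev v) :=
  ⟨2, .eq 0 1, ![s, t], .eq _ _, fun _ _ => Iff.rfl⟩

theorem D0.mem (s t : Tm.{u} ι) : D0 (fun v => s.ev v ∈ t.ev v) :=
  ⟨2, .mem 0 1, ![s, t], .mem _ _, fun _ _ => Iff.rfl⟩

/-- A bounded quantifier needs a variable as its bound, so `s`, possibly a constant, gets a slot of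
its own. The witness is in `H_{ω_2}` by transitivity. -/
theorem D0.bex (s : Tm.{u} ι) {P : (ι → ZFSet.{u}) → ZFSet.{u} → Prop}
    (h : D0 (fun w : Option ι → ZFSet.{u} => P (fun i => w (some i)) ((Tm.var none).ev w))) :
    D0 (fun v => ∃ y ∈ s.ev v, P v y) := by
  obtain ⟨m, ψ, t, hψ, H⟩ := h
  refine ⟨m + 1, .ex ((SetFormula.mem (Fin.last _) (Fin.last m).castSucc).and
      (ψ.rename fun j => if (t j).isNone then Fin.last _ else j.castSucc.castSucc)),
    Fin.snoc (fun j => (t j).drop) s, .bex _ (hψ.rename _), fun v hv => ?_⟩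
  have key : ∀ a ∈ Homega2, Sat Homega2
      (ψ.rename fun j => if (t j).isNone then Fin.last _ else j.castSucc.castSucc)
      (Fin.snoc (fun j => ((Fin.snoc (fun j => (t j).drop) s : Fin (m + 1) → Tm ι) j).ev v) a :
        Fin (m + 2) → ZFSet.{u}) ↔ P v a := by
    intro a ha
    rw [SetFormula.sat_rename]
    refine Iff.trans ?_ (H (fun o => o.elim a v) (fun o => ?_))
    · refine iff_of_eq (congrArg _ (funext fun j => ?_))
      rw [Tm.ev_extend]
      split_ifs <;> simp
    · cases o
      exacts [ha, hv _]
  simp only [Sat, Fin.snoc_last, Fin.snoc_castSucc]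
  constructor
  · rintro ⟨a, ha, h1, h2⟩
    exact ⟨a, h1, (key a ha).1 h2⟩
  · rintro ⟨a, h1, h2⟩
    have ha := mem_Homega2_of_mem (s.ev_mem hv) h1
    exact ⟨a, ha, h1, (key a ha).2 h2⟩

theorem D0.ball (s : Tm.{u} ι) {P : (ι → ZFSet.{u}) → ZFSet.{u} → Prop}
    (h : D0 (fun w : Option ι → ZFSet.{u} => P (fun i => w (some i)) ((Tm.var none).ev w))) :
    D0 (fun v => ∀ y ∈ s.ev v, P v y) := by
  refine (D0.bex s (P := fun v y => ¬ P v y) h.not).not.congr fun v _ => ?_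
  push Not
  rfl

theorem D0.trivial : D0 (fun _ : ι → ZFSet.{u} => True) :=
  (D0.eq (.const ∅ empty_mem_Homega2) (.const ∅ empty_mem_Homega2)).congr fun _ _ => by simp

theorem Lev.forall_fin {b : Bool} {k : ℕ} {n : ℕ} {P : Fin n → (ι → ZFSet.{u}) → Prop}
    (h : ∀ j, Lev b k (P j)) : Lev b k (fun v => ∀ j, P j v) := by
  induction n with
  | zero => exact D0.trivial.lev_of.congr fun v _ => by simp
  | succ n ih =>
    refine ((h 0).and (ih fun j => h j.succ)).congr fun v _ => ?_
    exact (Fin.forall_fin_succ (P := fun j => P j v)).symm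

theorem D0.forall_fin {n : ℕ} {P : Fin n → (ι → ZFSet.{u}) → Prop}
    (h : ∀ j, D0 (P j)) : D0 (fun v => ∀ j, P j v) :=
  (Lev.forall_fin (b := true) fun j => (h j).lev).d0

theorem D0.exists_fin {n : ℕ} {P : Fin n → (ι → ZFSet.{u}) → Prop}
    (h : ∀ j, D0 (P j)) : D0 (fun v => ∃ j, P j v) :=
  (D0.forall_fin fun j => (h j).not).not.congr fun v _ => by simp

theorem D0.bexFin {n : ℕ} {ι : Type v} (s : Tm.{u} ι)
    {P : (ι → ZFSet.{u}) → (Fin n → ZFSet.{u}) → Prop}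
    (h : D0 (fun w : ι ⊕ Fin n → ZFSet.{u} => P (fun i => w (.inl i)) (fun j => w (.inr j)))) :
    D0 (fun v => ∃ x : Fin n → ZFSet.{u}, (∀ j, x j ∈ s.ev v) ∧ P v x) := by
  induction n generalizing ι with
  | zero =>
    refine (h.comp (fun i : ι ⊕ Fin 0 => i.elim id Fin.elim0)).congr fun v _ => ?_
    constructor
    · exact fun h => ⟨_, fun j => j.elim0, h⟩
    · rintro ⟨x, _, h⟩
      convert! h using 2
  | succ n ih =>
    refine (D0.bex s (P := fun v y => ∃ x : Fin n → ZFSet.{u}, (∀ j, x j ∈ s.ev v) ∧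
      P v (Fin.cons y x : Fin (n + 1) → ZFSet.{u})) ?_).congr fun v _ => ?_
    · simp only [Tm.ev_comp]
      refine ih (ι := Option ι) _ ?_
      have := h.comp (κ := Option ι ⊕ Fin n) (Sum.elim (fun i => Sum.inl (some i))
        (Fin.cons (Sum.inl none) Sum.inr))
      refine this.congr fun w _ => ?_
      simp only [Sum.elim_inl, Sum.elim_inr]
      refine iff_of_eq (congrArg _ (funext fun j => ?_))
      refine Fin.cases ?_ (fun j => ?_) j <;> simp [Tm.ev]
    · constructor
      · rintro ⟨y, hy, x, hx, h⟩
        exact ⟨_, Fin.forall_fin_succ.2 ⟨by simpa using! hy, by simpa using! hx⟩, h⟩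
      · rintro ⟨x, hx, h⟩
        refine ⟨x 0, hx 0, fun j => x j.succ, fun j => hx _, ?_⟩
        convert! h
        exact Fin.cons_self_tail x

end

theorem Lev.exists_formula {b : Bool} {k n : ℕ} {X : Set (Fin n → ZFSet.{u})}
    (h : Lev b k (fun v => v ∈ X)) (hX : ∀ v ∈ X, ∀ i, v i ∈ Homega2) :
    ∃ (r : ℕ) (φ : SetFormula (n + r)) (p : Fin r → ZFSet.{u}),
      φ.IsLevy b k ∧ (∀ i, p i ∈ Homega2) ∧ X = definedRel Homega2 φ p := by
  obtain ⟨m, ψ, t, hψ, H⟩ := h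
  refine ⟨m, ψ.rename fun j => match t j with
    | .var i => Fin.castAdd m i
    | .const _ _ => Fin.natAdd n j, fun j => match t j with
    -- Dummy parameter: a slot filled with a variable never reads this position.
    | .var _ => ∅
    | .const a _ => a, hψ.rename _, fun j => ?_, ?_⟩
  · cases h : t j with
    | var i => simpa [h] using! empty_mem_Homega2
    | const a ha => simpa [h] using! ha
  · ext v
    constructor
    · intro hv
      refine ⟨hX v hv, ?_⟩
      rw [SetFormula.sat_rename]
      convert! (H v (hX v hv)).2 hv using 2 with j
      cases h : t j <;> simp [Tm.ev, h]
    · rintro ⟨hv, h⟩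
      rw [SetFormula.sat_rename] at h
      refine (H v hv).1 ?_
      convert! h using 2 with j
      cases h : t j <;> simp [Tm.ev, h]

theorem Lev.of_definedRel {b : Bool} {k n r : ℕ} {φ : SetFormula (n + r)}
    {p : Fin r → ZFSet.{u}} (hφ : φ.IsLevy b k) (hp : ∀ i, p i ∈ Homega2) :
    Lev b k (fun v => v ∈ definedRel Homega2 φ p) := by
  refine ⟨n + r, φ, Fin.append Tm.var (fun j => .const (p j) (hp j)), hφ, fun v hv => ?_⟩
  have : (fun j => ((Fin.append Tm.var (fun j => Tm.const (p j) (hp j)) :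
      Fin (n + r) → Tm (Fin n)) j).ev v) = Fin.append v p := by
    funext j
    refine Fin.addCases (fun i => ?_) (fun i => ?_) j <;> simp [Tm.ev]
  rw [this]
  exact ⟨fun h => ⟨hv, h⟩, fun h => h.2⟩

/-! ### Infinite sequences and strings. -/

/-- The function on `ω` with values `g i`. -/
noncomputable def graph (g : ℕ → ZFSet.{u}) : ZFSet.{u} :=
  ZFSet.range fun i : ℕ => ZFSet.pair (nat i) (g i)

/-- The string of length `n` with values `g i`. -/
noncomputable def seg (g : ℕ → ZFSet.{u}) (n : ℕ) : ZFSet.{u} :=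
  ZFSet.range fun i : Fin n => ZFSet.pair (nat i) (g i)

section strings
variable {g h : ℕ → ZFSet.{u}} {n m : ℕ} {B s t p : ZFSet.{u}}

theorem mem_graph : p ∈ graph g ↔ ∃ i, p = ZFSet.pair (nat i) (g i) := by
  simp [graph, eq_comm]

theorem mem_seg : p ∈ seg g n ↔ ∃ i < n, p = ZFSet.pair (nat i) (g i) := by
  rw [seg, ZFSet.mem_range]
  exact ⟨fun ⟨i, h⟩ => ⟨i, i.2, h.symm⟩, fun ⟨i, hi, h⟩ => ⟨⟨i, hi⟩, h.symm⟩⟩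

theorem pair_mem_graph {i : ℕ} {y : ZFSet.{u}} :
    ZFSet.pair (nat i) y ∈ graph g ↔ y = g i := by
  rw [mem_graph]
  constructor
  · rintro ⟨j, h⟩
    obtain ⟨h1, h2⟩ := ZFSet.pair_inj.1 h
    rw [nat_injective h1, h2]
  · rintro rfl
    exact ⟨i, rfl⟩

theorem pair_mem_seg {i : ℕ} {y : ZFSet.{u}} :
    ZFSet.pair (nat i) y ∈ seg g n ↔ i < n ∧ y = g i := by
  rw [mem_seg]
  constructor
  · rintro ⟨j, hj, h⟩
    obtain ⟨h1, h2⟩ := ZFSet.pair_inj.1 h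
    rw [nat_injective h1, h2]
    exact ⟨hj, rfl⟩
  · rintro ⟨h, rfl⟩
    exact ⟨i, h, rfl⟩

theorem seg_subset_graph : seg g n ⊆ graph h ↔ ∀ i < n, g i = h i := by
  constructor
  · intro H i hi
    exact pair_mem_graph.1 (H (pair_mem_seg.2 ⟨hi, rfl⟩))
  · intro H p hp
    obtain ⟨i, hi, rfl⟩ := mem_seg.1 hp
    exact pair_mem_graph.2 (H i hi)

theorem seg_subset_seg : seg g n ⊆ seg h m ↔ n ≤ m ∧ ∀ i < n, g i = h i := by
  constructor
  · intro H
    have H' : ∀ i < n, i < m ∧ g i = h i := fun i hi =>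
      pair_mem_seg.1 (H (pair_mem_seg.2 ⟨hi, rfl⟩))
    refine ⟨le_of_not_gt fun hlt => ?_, fun i hi => (H' i hi).2⟩
    exact lt_irrefl _ (H' m hlt).1
  · rintro ⟨H, H'⟩ p hp
    obtain ⟨i, hi, rfl⟩ := mem_seg.1 hp
    exact pair_mem_seg.2 ⟨hi.trans_le H, H' i hi⟩

theorem seg_congr (H : ∀ i < n, g i = h i) : seg g n = seg h n :=
  subset_antisymm (seg_subset_seg.2 ⟨le_rfl, H⟩)
    (seg_subset_seg.2 ⟨le_rfl, fun i hi => (H i hi).symm⟩)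

theorem seg_subset_graph_self (g : ℕ → ZFSet.{u}) (n : ℕ) : seg g n ⊆ graph g :=
  seg_subset_graph.2 fun _ _ => rfl

theorem seg_mono (g : ℕ → ZFSet.{u}) (h : n ≤ m) : seg g n ⊆ seg g m :=
  seg_subset_seg.2 ⟨h, fun _ _ => rfl⟩

theorem seg_succ (g : ℕ → ZFSet.{u}) (n : ℕ) :
    seg g (n + 1) = insert (ZFSet.pair (nat n) (g n)) (seg g n) := by
  ext p
  rw [ZFSet.mem_insert_iff, mem_seg, mem_seg]
  constructor
  · rintro ⟨i, hi, rfl⟩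
    rcases Nat.lt_succ_iff_lt_or_eq.1 hi with hi | rfl
    exacts [.inr ⟨i, hi, rfl⟩, .inl rfl]
  · rintro (rfl | ⟨i, hi, rfl⟩)
    exacts [⟨n, n.lt_succ_self, rfl⟩, ⟨i, hi.trans n.lt_succ_self, rfl⟩]

theorem restr_graph : restr (graph g) (nat n) = seg g n := by
  ext p
  rw [restr, ZFSet.mem_sep, mem_graph, mem_seg]
  constructor
  · rintro ⟨⟨i, rfl⟩, j, hj, y, h⟩
    obtain ⟨k, hk, rfl⟩ := mem_nat.1 hj
    have := nat_injective (ZFSet.pair_inj.1 h).1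
    exact ⟨i, this ▸ hk, rfl⟩
  · rintro ⟨i, hi, rfl⟩
    exact ⟨⟨i, rfl⟩, nat i, nat_mem_nat.2 hi, g i, rfl⟩

theorem isFunc_omega_iff : ZFSet.IsFunc ZFSet.omega B s ↔ ∃ g, (∀ i, g i ∈ B) ∧ s = graph g := by
  constructor
  · rintro ⟨h1, h2⟩
    choose g hg hg' using fun i : ℕ => h2 (nat i) (nat_mem_omega i)
    refine ⟨g, fun i => (ZFSet.pair_mem_prod.1 (h1 (hg i))).2, ?_⟩
    ext p
    rw [mem_graph]
    constructor
    · intro hp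
      obtain ⟨a, ha, b, hb, rfl⟩ := ZFSet.mem_prod.1 (h1 hp)
      obtain ⟨i, rfl⟩ := mem_omega.1 ha
      exact ⟨i, by rw [hg' i b hp]⟩
    · rintro ⟨i, rfl⟩
      exact hg i
  · rintro ⟨g, hg, rfl⟩
    refine ⟨fun p hp => ?_, fun z hz => ?_⟩
    · obtain ⟨i, rfl⟩ := mem_graph.1 hp
      exact ZFSet.pair_mem_prod.2 ⟨nat_mem_omega i, hg i⟩
    · obtain ⟨i, rfl⟩ := mem_omega.1 hz
      exact ⟨g i, pair_mem_graph.2 rfl, fun y hy => pair_mem_graph.1 hy⟩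

theorem isFunc_nat_iff :
    ZFSet.IsFunc (nat n) B s ↔ ∃ g, (∀ i < n, g i ∈ B) ∧ s = seg g n := by
  constructor
  · rintro ⟨h1, h2⟩
    choose! g hg hg' using fun (i : ℕ) (hi : i < n) => h2 (nat i) (nat_mem_nat.2 hi)
    refine ⟨g, fun i hi => (ZFSet.pair_mem_prod.1 (h1 (hg i hi))).2, ?_⟩
    ext p
    rw [mem_seg]
    constructor
    · intro hp
      obtain ⟨a, ha, b, hb, rfl⟩ := ZFSet.mem_prod.1 (h1 hp)
      obtain ⟨i, hi, rfl⟩ := mem_nat.1 ha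
      exact ⟨i, hi, by rw [hg' i hi b hp]⟩
    · rintro ⟨i, hi, rfl⟩
      exact hg i hi
  · rintro ⟨g, hg, rfl⟩
    refine ⟨fun p hp => ?_, fun z hz => ?_⟩
    · obtain ⟨i, hi, rfl⟩ := mem_seg.1 hp
      exact ZFSet.pair_mem_prod.2 ⟨nat_mem_nat.2 hi, hg i hi⟩
    · obtain ⟨i, hi, rfl⟩ := mem_nat.1 hz
      exact ⟨g i, pair_mem_seg.2 ⟨hi, rfl⟩, fun y hy => (pair_mem_seg.1 hy).2⟩

theorem isString_iff : IsString B s ↔ ∃ g n, (∀ i < n, g i ∈ B) ∧ s = seg g n := by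
  constructor
  · rintro ⟨n, hn, h⟩
    obtain ⟨n, rfl⟩ := mem_omega.1 hn
    obtain ⟨g, h⟩ := isFunc_nat_iff.1 h
    exact ⟨g, n, h⟩
  · rintro ⟨g, n, h⟩
    exact ⟨nat n, nat_mem_omega n, isFunc_nat_iff.2 ⟨g, h⟩⟩

theorem isString_seg (hg : ∀ i < n, g i ∈ B) : IsString B (seg g n) :=
  isString_iff.2 ⟨g, n, hg, rfl⟩

theorem seg_eq_of_subset_graph (ht : IsString B t) (h : t ⊆ graph g) : ∃ n, t = seg g n := by
  obtain ⟨k, n, _, rfl⟩ := isString_iff.1 ht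
  exact ⟨n, seg_congr (seg_subset_graph.1 h)⟩

theorem subset_total_of_subset_graph (hs : IsString B s) (ht : IsString B t) (h : s ⊆ graph g)
    (h' : t ⊆ graph g) : s ⊆ t ∨ t ⊆ s := by
  obtain ⟨n, rfl⟩ := seg_eq_of_subset_graph hs h
  obtain ⟨m, rfl⟩ := seg_eq_of_subset_graph ht h'
  exact (le_total n m).imp (seg_mono g) (seg_mono g)

/-- Proper extension makes the lengths grow strictly, so `s k` has length at least `k`, and entry
`i` of the limit can be read off `s (i + 1)`. -/
theorem exists_graph_of_chain {s : ℕ → ZFSet.{u}} (hs : ∀ k, IsString B (s k))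
    (h : ∀ k, s k ⊆ s (k + 1)) (h' : ∀ k, s k ≠ s (k + 1)) :
    ∃ g, (∀ i, g i ∈ B) ∧ ∀ k, s k ⊆ graph g ∧ seg g k ⊆ s k := by
  choose f l hf hfl using fun k => isString_iff.1 (hs k)
  have hmono : ∀ {a b}, a ≤ b → s a ⊆ s b := by
    intro a b hab
    induction hab with
    | refl => exact fun _ h => h
    | step _ ih => exact fun _ hz => h _ (ih hz)
  have hl : StrictMono l := by
    refine strictMono_nat_of_lt_succ fun k => ?_
    have h1 := h k
    have h2 := h' k
    rw [hfl k, hfl (k + 1)] at h1 h2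
    obtain ⟨h3, h4⟩ := seg_subset_seg.1 h1
    refine lt_of_le_of_ne h3 fun he => h2 ?_
    rw [← he]
    exact seg_congr h4
  have hid : ∀ k, k ≤ l k := hl.id_le
  have hval : ∀ k i, i < l k → f k i = f (i + 1) i := by
    intro k i hi
    rcases le_total k (i + 1) with hle | hle
    · have := hmono hle
      rw [hfl k, hfl (i + 1)] at this
      exact (seg_subset_seg.1 this).2 i hi
    · have := hmono hle
      rw [hfl k, hfl (i + 1)] at this
      exact ((seg_subset_seg.1 this).2 i (hid (i + 1))).symm
  refine ⟨fun i => f (i + 1) i, fun i => hf _ i (hid (i + 1)), fun k => ⟨?_, ?_⟩⟩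
  · rw [hfl k]
    exact seg_subset_graph.2 (hval k)
  · rw [hfl k]
    exact seg_subset_seg.2 ⟨hid k, fun i hi => (hval k i (hi.trans_le (hid k))).symm⟩

/-- The set of all strings of elements of `B`. -/
noncomputable def strSet (B : ZFSet.{u}) : ZFSet.{u} :=
  ZFSet.range fun l : List (Shrink.{u} B) =>
    seg (fun i => if h : i < l.length then ((equivShrink B).symm l[i]).1 else ∅) l.length

theorem mem_strSet : s ∈ strSet B ↔ IsString B s := by
  rw [strSet, ZFSet.mem_range, isString_iff]
  constructor
  · rintro ⟨l, rfl⟩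
    refine ⟨_, _, fun i hi => ?_, rfl⟩
    simp [hi]
  · rintro ⟨g, n, hg, rfl⟩
    refine ⟨List.ofFn fun i : Fin n => equivShrink B ⟨g i, hg i i.2⟩, ?_⟩
    exact (congrArg (seg _) List.length_ofFn).trans (seg_congr fun i hi => by simp [hi])

theorem isString_mem_Homega2 (hB : B ∈ Homega2) (hs : IsString B s) : s ∈ Homega2 := by
  obtain ⟨g, n, hg, rfl⟩ := isString_iff.1 hs
  induction n with
  | zero =>
    have : seg g 0 = ∅ := by
      rw [ZFSet.eq_empty]
      intro y hy
      obtain ⟨i, hi, _⟩ := mem_seg.1 hy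
      exact absurd hi (Nat.not_lt_zero i)
    rw [this]
    exact empty_mem_Homega2
  | succ n ih =>
    rw [seg_succ]
    have hg' : ∀ i < n, g i ∈ B := fun i hi => hg i (hi.trans n.lt_succ_self)
    exact insert_mem_Homega2 (pair_mem_Homega2 (mem_Homega2_of_mem omega_mem_Homega2
      (nat_mem_omega n)) (mem_Homega2_of_mem hB (hg n n.lt_succ_self)))
      (ih hg' (isString_seg hg'))

theorem strSet_mem_Homega2 (hB : B ∈ Homega2) : strSet B ∈ Homega2 := by
  refine range_mem_Homega2 ?_ fun l => isString_mem_Homega2 hB (mem_strSet.1 (ZFSet.mem_range_self l))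
  refine (mk_list_le_max _).trans_lt (max_lt ?_ (card_lt_of_mem_Homega2 hB))
  exact aleph0_lt_aleph.2 (by norm_num)

theorem isFunc_omega_mem_Homega2 (hB : B ∈ Homega2) (hs : ZFSet.IsFunc ZFSet.omega B s) :
    s ∈ Homega2 := by
  obtain ⟨g, hg, rfl⟩ := isFunc_omega_iff.1 hs
  refine mem_Homega2_of_card (lt_of_le_of_lt (b := ℵ₀) ?_ ?_) fun p hp => ?_
  · simpa [graph] using ZFSet.lift_card_range_le (f := fun i : ℕ => ZFSet.pair (nat i) (g i))
  · exact aleph0_lt_aleph.2 (by norm_num)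
  · obtain ⟨i, rfl⟩ := mem_graph.1 hp
    exact pair_mem_Homega2 (mem_Homega2_of_mem omega_mem_Homega2 (nat_mem_omega i))
      (mem_Homega2_of_mem hB (hg i))

end strings

/-! ### Codes of continuous functions and their rankings. -/

/-- The set of all strings of countable ordinals. -/
noncomputable def Str : ZFSet.{u} := strSet omegaOne

theorem mem_Str {s : ZFSet.{u}} : s ∈ Str ↔ IsString omegaOne s := mem_strSet

theorem Str_mem_Homega2 : Str.{u} ∈ Homega2 := strSet_mem_Homega2 omegaOne_mem_Homega2

/-- Initial segments of `x` become members of the parameter `Str` included in `x`, a bounded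
condition. -/
theorem exists_restr_eq_iff {x t : ZFSet.{u}} (hx : ZFSet.IsFunc ZFSet.omega omegaOne x) :
    (∃ m ∈ ZFSet.omega, t = restr x m) ↔ t ∈ Str ∧ t ⊆ x := by
  obtain ⟨g, hg, rfl⟩ := isFunc_omega_iff.1 hx
  rw [mem_Str]
  constructor
  · rintro ⟨m, hm, rfl⟩
    obtain ⟨m, rfl⟩ := mem_omega.1 hm
    rw [restr_graph]
    exact ⟨isString_seg fun i _ => hg i, seg_subset_graph_self g m⟩
  · rintro ⟨ht, ht'⟩
    obtain ⟨n, rfl⟩ := seg_eq_of_subset_graph ht ht'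
    exact ⟨nat n, nat_mem_omega n, restr_graph.symm⟩

/-- `⟨⟨s, i⟩, ξ⟩ ∈ c`. -/
def Entry (c s i ξ : ZFSet.{u}) : Prop := ZFSet.pair (ZFSet.pair s i) ξ ∈ c

/-- The string or infinite sequence `s` decides the value at `i` of the function coded by `c`. -/
def Decides (c s i : ZFSet.{u}) : Prop := ∃ t ∈ Str.{u}, t ⊆ s ∧ ∃ ξ, Entry c t i ξ

/-- The part of the definition of `CCF ϑ` that does not mention infinite sequences. -/
def IsPrecode (ϑ c : ZFSet.{u}) : Prop :=
  (∀ p ∈ c, ∃ s ∈ Str.{u}, ∃ i ∈ ZFSet.omega.{u}, ∃ ξ, Entry c s i ξ ∧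
    (ξ ∈ ϑ ∧ p = ZFSet.pair (ZFSet.pair s i) ξ)) ∧
  ∀ i ∈ ZFSet.omega.{u}, ∀ s ∈ Str.{u}, ∀ t ∈ Str.{u}, (s ⊆ t ∨ t ⊆ s) →
    ∀ ξ, Entry c s i ξ → ∀ η, Entry c t i η → ξ = η

section codes
variable {ϑ c d s t x i ξ η : ZFSet.{u}} {g : ℕ → ZFSet.{u}}

theorem Decides.mono (h : Decides c s i) (hst : s ⊆ t) : Decides c t i := by
  obtain ⟨r, hr, hrs, h⟩ := h
  exact ⟨r, hr, fun _ hz => hst (hrs hz), h⟩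

theorem IsPrecode.of_entry (hc : IsPrecode ϑ c) (h : Entry c s i ξ) :
    s ∈ Str ∧ i ∈ ZFSet.omega ∧ ξ ∈ ϑ := by
  obtain ⟨s', hs, i', hi, ξ', _, hξ, he⟩ := hc.1 _ h
  obtain ⟨he1, rfl⟩ := ZFSet.pair_inj.1 he
  obtain ⟨rfl, rfl⟩ := ZFSet.pair_inj.1 he1
  exact ⟨hs, hi, hξ⟩

theorem IsPrecode.mono {ϑ' : ZFSet.{u}} (hc : IsPrecode ϑ c) (h : ϑ ⊆ ϑ') : IsPrecode ϑ' c := by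
  refine ⟨fun p hp => ?_, hc.2⟩
  obtain ⟨s, hs, i, hi, ξ, he, hξ, rfl⟩ := hc.1 p hp
  exact ⟨s, hs, i, hi, ξ, he, h hξ, rfl⟩

/-- Single-valuedness of a code is the case `s = t` of the coherence clause of `IsPrecode`. -/
theorem mem_CCF_iff : c ∈ CCF ϑ ↔ IsPrecode ϑ c ∧
    ∀ x, ZFSet.IsFunc ZFSet.omega omegaOne x → ∀ i ∈ ZFSet.omega.{u}, Decides c x i := by
  constructor
  · rintro ⟨h1, h2, h3, h4⟩
    refine ⟨⟨fun p hp => ?_, fun i hi s _ t _ hst ξ hξ η hη => ?_⟩, fun x hx i hi => ?_⟩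
    · obtain ⟨s, i, ξ, hs, hi, hξ, rfl⟩ := h1 p hp
      exact ⟨s, mem_Str.2 hs, i, hi, ξ, hp, hξ, rfl⟩
    · by_contra hne
      exact h3 i hi ξ η hne s t hξ hη hst
    · obtain ⟨m, hm, ξ, h⟩ := h4 i hi x hx
      obtain ⟨ht, hsub⟩ := (exists_restr_eq_iff hx).1 ⟨m, hm, rfl⟩
      exact ⟨_, ht, hsub, ξ, h⟩
  · rintro ⟨h, h'⟩
    refine ⟨fun p hp => ?_, fun a ξ η hξ hη => ?_, fun i hi ξ η hne s t hξ hη hst => ?_,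
      fun i hi x hx => ?_⟩
    · obtain ⟨s, hs, i, hi, ξ, _, hξ, rfl⟩ := h.1 p hp
      exact ⟨s, i, ξ, mem_Str.1 hs, hi, hξ, rfl⟩
    · obtain ⟨s, hs, i, hi, ξ', _, _, he⟩ := h.1 _ hξ
      obtain ⟨rfl, rfl⟩ := ZFSet.pair_inj.1 he
      exact h.2 i hi s hs s hs (.inl fun _ h => h) _ hξ _ hη
    · exact hne (h.2 i hi s (h.of_entry hξ).1 t (h.of_entry hη).1 hst ξ hξ η hη)
    · obtain ⟨t, ht, htx, ξ, he⟩ := h' x hx i hi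
      obtain ⟨m, hm, rfl⟩ := (exists_restr_eq_iff hx).2 ⟨ht, htx⟩
      exact ⟨m, hm, ξ, he⟩

theorem CCF_mono {ϑ' : ZFSet.{u}} (h : ϑ ⊆ ϑ') : CCF ϑ ⊆ CCF ϑ' := fun _ hc =>
  mem_CCF_iff.2 ⟨(mem_CCF_iff.1 hc).1.mono h, (mem_CCF_iff.1 hc).2⟩

theorem mk_shrink_Str_prod_omega_lt : #(Shrink.{u} Str.{u} × Shrink.{u} ZFSet.omega.{u}) < ℵ_ 2 := by
  rw [mk_prod, lift_id, lift_id]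
  exact mul_lt_of_lt (aleph0_le_aleph 2) (card_lt_of_mem_Homega2 Str_mem_Homega2)
    (card_lt_of_mem_Homega2 omega_mem_Homega2)

/-- The set of all `⟨⟨s, i⟩, f s i⟩` for `s` a string and `i` a natural number. -/
noncomputable def tableOf (f : ZFSet.{u} → ZFSet.{u} → ZFSet.{u}) : ZFSet.{u} :=
  ZFSet.range fun p : Shrink.{u} Str.{u} × Shrink.{u} ZFSet.omega.{u} =>
    ZFSet.pair (ZFSet.pair ((equivShrink _).symm p.1).1 ((equivShrink _).symm p.2).1)
      (f ((equivShrink _).symm p.1).1 ((equivShrink _).symm p.2).1)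

theorem mem_tableOf {f : ZFSet.{u} → ZFSet.{u} → ZFSet.{u}} {p : ZFSet.{u}} :
    p ∈ tableOf f ↔ ∃ s ∈ Str, ∃ i ∈ ZFSet.omega, p = ZFSet.pair (ZFSet.pair s i) (f s i) := by
  rw [tableOf, ZFSet.mem_range]
  constructor
  · rintro ⟨⟨a, b⟩, rfl⟩
    exact ⟨_, ((equivShrink _).symm a).2, _, ((equivShrink _).symm b).2, rfl⟩
  · rintro ⟨s, hs, i, hi, rfl⟩
    exact ⟨(equivShrink _ ⟨s, hs⟩, equivShrink _ ⟨i, hi⟩), by simp⟩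

theorem entry_tableOf {f : ZFSet.{u} → ZFSet.{u} → ZFSet.{u}} :
    Entry (tableOf f) s i ξ ↔ s ∈ Str ∧ i ∈ ZFSet.omega ∧ ξ = f s i := by
  rw [Entry, mem_tableOf]
  constructor
  · rintro ⟨s', hs, i', hi, he⟩
    obtain ⟨he1, rfl⟩ := ZFSet.pair_inj.1 he
    obtain ⟨rfl, rfl⟩ := ZFSet.pair_inj.1 he1
    exact ⟨hs, hi, rfl⟩
  · rintro ⟨hs, hi, rfl⟩
    exact ⟨s, hs, i, hi, rfl⟩

theorem tableOf_mem_Homega2 {f : ZFSet.{u} → ZFSet.{u} → ZFSet.{u}}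
    (h : ∀ s ∈ Str, ∀ i ∈ ZFSet.omega, f s i ∈ Homega2) : tableOf f ∈ Homega2 := by
  refine range_mem_Homega2 mk_shrink_Str_prod_omega_lt fun p => ?_
  have h1 := ((equivShrink Str.{u}).symm p.1).2
  have h2 := ((equivShrink ZFSet.omega.{u}).symm p.2).2
  exact pair_mem_Homega2 (pair_mem_Homega2 (mem_Homega2_of_mem Str_mem_Homega2 h1)
    (mem_Homega2_of_mem omega_mem_Homega2 h2)) (h _ h1 _ h2)

/-- By coherence `c` is included in the table of a function on `Str × ω`. Only the elements of `ϑ`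
need lie in `H_{ω_2}`, which admits `ϑ = Θ`. -/
theorem IsPrecode.mem_Homega2 (hc : IsPrecode ϑ c) (hϑ : ∀ ξ ∈ ϑ, ξ ∈ Homega2) :
    c ∈ Homega2 := by
  classical
  let f : ZFSet.{u} → ZFSet.{u} → ZFSet.{u} := fun s i =>
    if h : ∃ ξ, Entry c s i ξ then h.choose else ∅
  refine mem_Homega2_of_subset (x := tableOf f) (tableOf_mem_Homega2 fun s _ i _ => ?_) ?_
  · by_cases h : ∃ ξ, Entry c s i ξ
    · simp only [f, dif_pos h]
      exact hϑ _ (hc.of_entry h.choose_spec).2.2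
    · simp only [f, dif_neg h]
      exact empty_mem_Homega2
  · intro p hp
    obtain ⟨s, hs, i, hi, ξ, he, _, rfl⟩ := hc.1 p hp
    refine mem_tableOf.2 ⟨s, hs, i, hi, ?_⟩
    have h : ∃ ξ, Entry c s i ξ := ⟨ξ, he⟩
    simp only [f, dif_pos h]
    rw [hc.2 i hi s hs s hs (.inl fun _ h => h) _ he _ h.choose_spec]

theorem mem_Homega2_of_mem_CCF_Theta (hc : c ∈ CCF Θ) : c ∈ Homega2 :=
  (mem_CCF_iff.1 hc).1.mem_Homega2 fun _ h => (mem_Theta.1 h).2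

theorem mem_Homega2_of_mem_CCF_omega (hc : c ∈ CCF ZFSet.omega) : c ∈ Homega2 :=
  mem_Homega2_of_mem_CCF_Theta (CCF_mono omega_subset_Theta hc)

/-- `t` is a string extending `s` properly and not deciding the value at `i` of the function
coded by `c`. -/
def Above (c i t s : ZFSet.{u}) : Prop := t ∈ Str ∧ s ⊆ t ∧ s ≠ t ∧ ¬ Decides c t i

/-- An infinite chain of proper extensions undecided at `i` has as its limit a sequence `x`. A
string deciding `x` at `i` is finite, hence included in a member of the chain, which is absurd. -/
theorem wellFounded_above
    (h : ∀ x, ZFSet.IsFunc ZFSet.omega omegaOne.{u} x → Decides c x i) :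
    WellFounded (Above c i) := by
  rw [wellFounded_iff_isEmpty_descending_chain]
  refine ⟨fun ⟨s, hs⟩ => ?_⟩
  -- The shift drops `s 0`, the only term of the chain not known to be a string.
  obtain ⟨g, hg, hgs⟩ := exists_graph_of_chain (s := fun k => s (k + 1))
    (fun k => mem_Str.1 (hs k).1) (fun k => (hs (k + 1)).2.1) (fun k => (hs (k + 1)).2.2.1)
  obtain ⟨t, ht, htg, hd⟩ := h (graph g) (isFunc_omega_iff.2 ⟨g, hg, rfl⟩)
  obtain ⟨m, rfl⟩ := seg_eq_of_subset_graph (mem_Str.1 ht) htg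
  exact (hs m).2.2.2 ⟨_, ht, (hgs m).2, hd⟩

/-- `F` assigns sets to the pairs `⟨s, i⟩` such that the value at `i` is not decided by `s`, in a
way that reverses proper extension to membership. -/
def IsRanking (c F : ZFSet.{u}) : Prop :=
  ∀ i ∈ ZFSet.omega.{u}, ∀ s ∈ Str.{u}, Decides c s i ∨ ((∃ a, Entry F s i a) ∧
    ∀ t ∈ Str.{u}, s ⊆ t → s ≠ t → ¬ Decides c t i →
      ∀ a, Entry F s i a → ∀ b, Entry F t i b → b ∈ a)

/-- Recursion along `Above` collapses each string to the set of the values of the undecided strings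
above it. There are at most `ℵ_1` strings, so the values and their table stay in `H_{ω_2}`. -/
theorem exists_isRanking
    (h : ∀ x, ZFSet.IsFunc ZFSet.omega omegaOne.{u} x → ∀ i ∈ ZFSet.omega.{u}, Decides c x i) :
    ∃ F ∈ Homega2, IsRanking c F := by
  have key : ∀ i ∈ ZFSet.omega.{u}, ∃ f : ZFSet.{u} → ZFSet.{u}, (∀ s, f s ∈ Homega2) ∧
      ∀ s t, Above c i t s → f t ∈ f s := by
    intro i hi
    have wf := wellFounded_above fun x hx => h x hx i hi
    let f : ZFSet.{u} → ZFSet.{u} := wf.fix fun s ih =>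
      ZFSet.range fun t : {t : Shrink.{u} Str.{u} // Above c i ((equivShrink _).symm t).1 s} =>
        ih _ t.2
    have hf : ∀ s, f s = ZFSet.range
        fun t : {t : Shrink.{u} Str.{u} // Above c i ((equivShrink _).symm t).1 s} =>
          f ((equivShrink _).symm t.1).1 := fun s => wf.fix_eq _ s
    refine ⟨f, fun s => ?_, fun s t hst => ?_⟩
    · induction s using wf.induction with
      | _ s ih =>
        rw [hf]
        exact range_mem_Homega2 ((mk_subtype_le _).trans_lt
          (card_lt_of_mem_Homega2 Str_mem_Homega2)) fun t => ih _ t.2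
    · rw [hf s]
      refine ZFSet.mem_range.2 ⟨⟨equivShrink _ ⟨t, hst.1⟩, by simpa using hst⟩, by simp⟩
  choose! f hf hf' using key
  refine ⟨tableOf fun s i => f i s, tableOf_mem_Homega2 fun s _ i hi => hf i hi s, ?_⟩
  refine fun i hi s hs => .inr ⟨⟨_, entry_tableOf.2 ⟨hs, hi, rfl⟩⟩, ?_⟩
  intro t ht hst hne hd a ha b hb
  obtain ⟨_, _, rfl⟩ := entry_tableOf.1 ha
  obtain ⟨_, _, rfl⟩ := entry_tableOf.1 hb
  exact hf' i hi s t ⟨ht, hst, hne, hd⟩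

/-- Along a sequence never decided at `i`, the ranks of the initial segments would form an infinite
`∈`-descending chain. -/
theorem IsRanking.decides {F : ZFSet.{u}} (hF : IsRanking c F)
    (hx : ZFSet.IsFunc ZFSet.omega omegaOne.{u} x) (hi : i ∈ ZFSet.omega) : Decides c x i := by
  by_contra hd
  obtain ⟨g, hg, rfl⟩ := isFunc_omega_iff.1 hx
  have hs : ∀ m, seg g m ∈ Str := fun m => mem_Str.2 (isString_seg fun i _ => hg i)
  have hnd : ∀ m, ¬ Decides c (seg g m) i := fun m h => hd (h.mono (seg_subset_graph_self g m))
  have hF' := fun m => (hF i hi (seg g m) (hs m)).resolve_left (hnd m)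
  choose a ha using fun m => (hF' m).1
  have hdesc : ∀ m, a (m + 1) ∈ a m := fun m => by
    refine (hF' m).2 _ (hs (m + 1)) (seg_mono g m.le_succ) (fun he => ?_) (hnd _) _ (ha m) _
      (ha (m + 1))
    have := (seg_subset_seg.1 he.symm.subset).1
    omega
  exact (wellFounded_iff_isEmpty_descending_chain.1 ZFSet.mem_wf).false ⟨a, hdesc⟩

theorem mem_CCF_iff_exists_isRanking :
    c ∈ CCF ϑ ↔ IsPrecode ϑ c ∧ ∃ F ∈ Homega2, IsRanking c F := by
  rw [mem_CCF_iff]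
  exact and_congr_right fun _ => ⟨exists_isRanking, fun ⟨F, _, hF⟩ x hx i hi => hF.decides hx hi⟩

theorem mem_restr_codeFun (hc : IsPrecode ϑ c) (hx : ZFSet.IsFunc ZFSet.omega omegaOne.{u} x)
    {m p : ZFSet.{u}} : p ∈ restr (codeFun ϑ c x) m ↔
      ∃ i ∈ m, ∃ t ∈ Str, t ⊆ x ∧ ∃ ξ, Entry c t i ξ ∧ p = ZFSet.pair i ξ := by
  rw [restr, ZFSet.mem_sep, codeFun, ZFSet.mem_sep]
  constructor
  · rintro ⟨⟨_, i, ξ, rfl, l, hl, he⟩, j, hj, y, h⟩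
    obtain ⟨rfl, rfl⟩ := ZFSet.pair_inj.1 h
    obtain ⟨ht, ht'⟩ := (exists_restr_eq_iff hx).1 ⟨l, hl, rfl⟩
    exact ⟨i, hj, _, ht, ht', ξ, he, rfl⟩
  · rintro ⟨i, hi, t, ht, htx, ξ, he, rfl⟩
    obtain ⟨l, hl, rfl⟩ := (exists_restr_eq_iff hx).2 ⟨ht, htx⟩
    obtain ⟨-, h2, h3⟩ := hc.of_entry he
    exact ⟨⟨ZFSet.pair_mem_prod.2 ⟨h2, h3⟩, i, ξ, rfl, l, hl, he⟩, i, hi, ξ, rfl⟩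

/-- Allows codes into `ω` and codes into `Θ` to be treated alike, as members of `CCF Θ`. -/
theorem restr_codeFun_eq_of_subset {ϑ' m : ZFSet.{u}} (hc : IsPrecode ϑ c) (h : ϑ ⊆ ϑ')
    (hx : ZFSet.IsFunc ZFSet.omega omegaOne.{u} x) :
    restr (codeFun ϑ c x) m = restr (codeFun ϑ' c x) m := by
  ext p
  rw [mem_restr_codeFun hc hx, mem_restr_codeFun (hc.mono h) hx]

theorem isString_restr_codeFun {B m : ZFSet.{u}} (hc : c ∈ CCF ϑ)
    (hx : ZFSet.IsFunc ZFSet.omega omegaOne.{u} x) (hm : m ∈ ZFSet.omega)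
    (hB : ∀ t i ξ, Entry c t i ξ → ξ ∈ B) : IsString B (restr (codeFun ϑ c x) m) := by
  obtain ⟨hc, hd⟩ := mem_CCF_iff.1 hc
  obtain ⟨m, rfl⟩ := mem_omega.1 hm
  choose t ht htx v hv using fun i : ℕ => hd x hx (nat i) (nat_mem_omega i)
  refine isString_iff.2 ⟨v, m, fun i _ => hB _ _ _ (hv i), ?_⟩
  obtain ⟨g, hg, rfl⟩ := isFunc_omega_iff.1 hx
  ext p
  rw [mem_restr_codeFun hc hx, mem_seg]
  constructor
  · rintro ⟨i, hi, t', ht', htx', ξ, he, rfl⟩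
    obtain ⟨i, him, rfl⟩ := mem_nat.1 hi
    refine ⟨i, him, ?_⟩
    rw [hc.2 _ (nat_mem_omega i) _ ht' _ (ht i) (subset_total_of_subset_graph (mem_Str.1 ht')
      (mem_Str.1 (ht i)) htx' (htx i)) _ he _ (hv i)]
  · rintro ⟨i, hi, rfl⟩
    exact ⟨_, nat_mem_nat.2 hi, t i, ht i, htx i, v i, hv i, rfl⟩

/-- `u` is the sequence of all values decided by `s` at members of `m`. -/
def IsDecided (c s m u : ZFSet.{u}) : Prop :=
  (∀ p ∈ u, ∃ i ∈ m, ∃ t ∈ Str.{u}, t ⊆ s ∧ ∃ ξ, Entry c t i ξ ∧ p = ZFSet.pair i ξ) ∧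
  ∀ i ∈ m, ∀ t ∈ Str.{u}, t ⊆ s → ∀ ξ, Entry c t i ξ → ZFSet.pair i ξ ∈ u

/-- Strings included in the same `x` are comparable, so their decisions agree: what `s` decides is
already the value for every `x` through `s`. This replaces a statement about `x` by a bounded one
about `s`. -/
theorem isDecided_iff {m w : ZFSet.{u}} (hc : IsPrecode ϑ c)
    (hx : ZFSet.IsFunc ZFSet.omega omegaOne.{u} x) (hs : s ⊆ x)
    (hd : ∀ i ∈ m, Decides c s i) : IsDecided c s m w ↔ w = restr (codeFun ϑ c x) m := by
  obtain ⟨g, hg, rfl⟩ := isFunc_omega_iff.1 hx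
  have key : ∀ p, p ∈ restr (codeFun ϑ c (graph g)) m ↔
      ∃ i ∈ m, ∃ t ∈ Str, t ⊆ s ∧ ∃ ξ, Entry c t i ξ ∧ p = ZFSet.pair i ξ := by
    intro p
    rw [mem_restr_codeFun hc hx]
    constructor
    · rintro ⟨i, hi, t, ht, htx, ξ, he, rfl⟩
      obtain ⟨t', ht', hts', η, he'⟩ := hd i hi
      have := hc.2 i (hc.of_entry he).2.1 t ht t' ht' (subset_total_of_subset_graph
        (mem_Str.1 ht) (mem_Str.1 ht') htx fun _ h => hs (hts' h)) ξ he η he'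
      exact ⟨i, hi, t', ht', hts', η, he', by rw [this]⟩
    · rintro ⟨i, hi, t, ht, hts, h⟩
      exact ⟨i, hi, t, ht, fun _ h => hs (hts h), h⟩
  constructor
  · rintro ⟨h1, h2⟩
    ext p
    rw [key]
    refine ⟨h1 p, ?_⟩
    rintro ⟨i, hi, t, ht, hts, ξ, he, rfl⟩
    exact h2 i hi t ht hts ξ he
  · rintro rfl
    exact ⟨fun p hp => (key p).1 hp, fun i hi t ht hts ξ he =>
      (key _).2 ⟨i, hi, t, ht, hts, ξ, he, rfl⟩⟩

theorem exists_seg_decides {N : ℕ} {e : Fin N → ZFSet.{u}} (he : ∀ j, e j ∈ CCF ϑ)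
    (hg : ∀ i, g i ∈ omegaOne) {m : ZFSet.{u}} (hm : m ∈ ZFSet.omega) :
    ∃ l, ∀ j, ∀ i ∈ m, Decides (e j) (seg g l) i := by
  obtain ⟨m, rfl⟩ := mem_omega.1 hm
  have hx := isFunc_omega_iff.2 ⟨g, hg, rfl⟩
  have : ∀ (j : Fin N) (i : ℕ), ∃ l, Decides (e j) (seg g l) (nat i) := by
    intro j i
    obtain ⟨t, ht, htx, h⟩ := (mem_CCF_iff.1 (he j)).2 _ hx (nat i) (nat_mem_omega i)
    obtain ⟨l, rfl⟩ := seg_eq_of_subset_graph (mem_Str.1 ht) htx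
    exact ⟨l, _, ht, fun _ h => h, h⟩
  choose l hl using this
  refine ⟨Finset.univ.sup fun j => (Finset.range m).sup (l j), fun j i hi => ?_⟩
  obtain ⟨i, him, rfl⟩ := mem_nat.1 hi
  refine (hl j i).mono (seg_mono g ?_)
  exact (Finset.le_sup (f := l j) (Finset.mem_range.2 him)).trans
    (Finset.le_sup (f := fun j => (Finset.range m).sup (l j)) (Finset.mem_univ j))

end codes

/-! ### Wide trees and their branches. -/

/-- The string `t` extends the string `s` by the single entry `⟨n, ξ⟩`. -/
def OneStep (s t n ξ : ZFSet.{u}) : Prop :=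
  s ⊆ t ∧ ∃ p ∈ t, p = ZFSet.pair n ξ ∧ p ∉ s ∧ ∀ q ∈ t, q ∈ s ∨ q = p

/-- Some member of `T` extends `s` by an entry with value `ξ`. -/
def IsLastValue (T s t ξ : ZFSet.{u}) : Prop :=
  t ∈ T ∧ ∃ n ∈ ZFSet.omega.{u}, OneStep s t n ξ

section trees
variable {T s t x : ZFSet.{u}} {g : ℕ → ZFSet.{u}} {l : ℕ}

theorem mem_treeSucc_seg (hg : ∀ i < l, g i ∈ omegaOne) :
    t ∈ treeSucc T (seg g l) ↔
      t ∈ T ∧ ∃ ξ ∈ omegaOne, t = insert (ZFSet.pair (nat l) ξ) (seg g l) := by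
  rw [treeSucc, ZFSet.mem_sep]
  refine and_congr_right fun ht => ?_
  constructor
  · rintro ⟨hst, n, hn, hs, ht'⟩
    obtain ⟨n, rfl⟩ := mem_omega.1 hn
    rw [← nat_succ] at ht'
    obtain ⟨h, hh, rfl⟩ := isFunc_nat_iff.1 ht'
    obtain ⟨h', hh', he⟩ := isFunc_nat_iff.1 hs
    have hln : l = n := le_antisymm (seg_subset_seg.1 he.subset).1
      (seg_subset_seg.1 he.symm.subset).1
    subst hln
    refine ⟨h l, hh l l.lt_succ_self, ?_⟩
    rw [seg_succ, seg_congr (seg_subset_seg.1 hst).2]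
  · rintro ⟨ξ, hξ, rfl⟩
    refine ⟨fun p hp => ZFSet.mem_insert_of_mem _ hp, nat l, nat_mem_omega l,
      isFunc_nat_iff.2 ⟨g, hg, rfl⟩, ?_⟩
    rw [← nat_succ]
    refine isFunc_nat_iff.2 ⟨fun i => if i = l then ξ else g i, fun i hi => ?_, ?_⟩
    · dsimp only
      split_ifs with h
      exacts [hξ, hg i (by omega)]
    · rw [seg_succ, if_pos rfl]
      congr 1
      exact seg_congr fun i hi => by rw [if_neg hi.ne]

theorem pair_notMem_seg {ξ : ZFSet.{u}} : ZFSet.pair (nat l) ξ ∉ seg g l := fun h =>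
  lt_irrefl _ (pair_mem_seg.1 h).1

/-- `OneStep` does not mention the length of `s`: since `t` is a string, its only new pair must sit
at index `l`. -/
theorem oneStep_seg_iff {n ξ : ZFSet.{u}} (ht : IsString omegaOne t) :
    OneStep (seg g l) t n ξ ↔
      ξ ∈ omegaOne ∧ n = nat l ∧ t = insert (ZFSet.pair (nat l) ξ) (seg g l) := by
  constructor
  · rintro ⟨hst, p, hp, rfl, hps, h⟩
    obtain ⟨f, m, hf, rfl⟩ := isString_iff.1 ht
    obtain ⟨hlm, hgf⟩ := seg_subset_seg.1 hst
    obtain ⟨j, hj, he⟩ := mem_seg.1 hp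
    obtain ⟨rfl, rfl⟩ := ZFSet.pair_inj.1 he
    have hlj : l ≤ j := by
      by_contra hlt
      rw [not_le] at hlt
      exact hps (pair_mem_seg.2 ⟨hlt, (hgf j hlt).symm⟩)
    -- The pair of `t` at index `l` is new as well, so it is the new pair `p`.
    have hjl : j = l := by
      rcases h _ (pair_mem_seg.2 ⟨hlj.trans_lt hj, rfl⟩) with h | h
      · exact absurd h pair_notMem_seg
      · exact (nat_injective (ZFSet.pair_inj.1 h).1).symm
    subst hjl
    refine ⟨hf j hj, rfl, ?_⟩
    ext q
    rw [ZFSet.mem_insert_iff]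
    refine ⟨fun hq => (h q hq).symm, ?_⟩
    rintro (rfl | hq)
    exacts [hp, hst hq]
  · rintro ⟨-, rfl, rfl⟩
    refine ⟨fun p hp => ZFSet.mem_insert_of_mem _ hp, _, ZFSet.mem_insert _ _, rfl,
      pair_notMem_seg, fun q hq => (ZFSet.mem_insert_iff.1 hq).symm⟩

theorem mem_treeSucc_iff (hT : ∀ t ∈ T, IsString omegaOne t) (hs : s ∈ T) :
    t ∈ treeSucc T s ↔ ∃ ξ ∈ omegaOne, IsLastValue T s t ξ := by
  obtain ⟨g, l, hg, rfl⟩ := isString_iff.1 (hT s hs)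
  rw [mem_treeSucc_seg hg]
  constructor
  · rintro ⟨ht, ξ, hξ, he⟩
    exact ⟨ξ, hξ, ht, nat l, nat_mem_omega l, (oneStep_seg_iff (hT t ht)).2 ⟨hξ, rfl, he⟩⟩
  · rintro ⟨ξ, hξ, ht, n, _, h⟩
    exact ⟨ht, ξ, hξ, ((oneStep_seg_iff (hT t ht)).1 h).2.2⟩

theorem two_le_card_iff {a : ZFSet.{u}} : 2 ≤ a.card ↔ ∃ x ∈ a, ∃ y ∈ a, x ≠ y := by
  rw [← lift_le.{u + 1}, ← ZFSet.cardinalMk_coe_sort, lift_two, two_le_iff]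
  constructor
  · rintro ⟨x, y, h⟩
    exact ⟨x, x.2, y, y.2, fun he => h (Subtype.ext he)⟩
  · rintro ⟨x, hx, y, hy, h⟩
    exact ⟨⟨x, hx⟩, ⟨y, hy⟩, fun he => h (congrArg Subtype.val he)⟩

theorem isBranchingNode_iff (hT : ∀ t ∈ T, IsString omegaOne t) :
    IsBranchingNode T s ↔ s ∈ T ∧ ∃ r ∈ T, ∃ r' ∈ T, (∃ ξ ∈ omegaOne, IsLastValue T s r ξ) ∧
      (∃ ξ ∈ omegaOne, IsLastValue T s r' ξ) ∧ r ≠ r' := by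
  refine and_congr_right fun hs => ?_
  rw [two_le_card_iff]
  simp only [mem_treeSucc_iff hT hs]
  constructor
  · rintro ⟨r, hr, r', hr', hne⟩
    obtain ⟨ξ, hξ, h⟩ := hr
    obtain ⟨ξ', hξ', h'⟩ := hr'
    exact ⟨r, h.1, r', h'.1, ⟨ξ, hξ, h⟩, ⟨ξ', hξ', h'⟩, hne⟩
  · rintro ⟨r, _, r', _, h, h', hne⟩
    exact ⟨r, h, r', h', hne⟩

/-- Regularity of `ω_1`: a countable set of countable ordinals is bounded below `ω_1`, while a
bounded one lies in a countable initial segment. This expresses cardinality `ℵ_1` without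
quantifying over bijections. -/
theorem mk_eq_aleph_one_iff {X : Set Ordinal.{u}} (hX : ∀ a ∈ X, a < Ordinal.omega 1) :
    #X = ℵ_ 1 ↔ ∀ a < Ordinal.omega 1, ∃ b ∈ X, a < b := by
  have hIio : ∀ a : Ordinal.{u}, #(Set.Iio a) = lift.{u + 1} a.card := Cardinal.mk_Iio_ordinal
  have hle : #X ≤ ℵ_ 1 := by
    refine (mk_le_mk_of_subset (t := Set.Iio (Ordinal.omega 1)) hX).trans ?_
    rw [hIio]
    simp
  constructor
  · intro h a ha
    by_contra! hb
    have h1 : #X ≤ #(Set.Iio (a + 1)) := mk_le_mk_of_subset fun b hb' =>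
      Set.mem_Iio.2 (Order.lt_add_one_iff.2 (hb b hb'))
    have h2 : (a + 1).card < ℵ_ 1 := by
      rw [← Cardinal.lt_ord, Cardinal.ord_aleph]
      exact (Cardinal.isSuccLimit_omega 1).succ_lt ha
    rw [h, hIio] at h1
    have h3 := h1.trans_lt (lift_lt.{u, u + 1}.2 h2)
    simp at h3
  · intro h
    refine le_antisymm hle ?_
    by_contra! hlt
    have hc : Countable X := by
      rw [← Cardinal.mk_le_aleph0_iff]
      rwa [← Order.lt_succ_iff, Cardinal.succ_aleph0]
    have := Ordinal.iSup_lt_omega_one (f := fun a : X => a.1) fun a => hX a a.2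
    obtain ⟨b, hb, hlt⟩ := h _ this
    exact absurd (Ordinal.le_iSup (fun a : X => a.1) ⟨b, hb⟩) hlt.not_ge

theorem card_treeSucc_iff (hT : ∀ t ∈ T, IsString omegaOne t) (hs : s ∈ T) :
    (treeSucc T s).card = ℵ_ 1 ↔ ∀ α ∈ omegaOne, ∃ ξ ∈ omegaOne, α ∈ ξ ∧
      ∃ r ∈ T, IsLastValue T s r ξ := by
  obtain ⟨g, l, hg, rfl⟩ := isString_iff.1 (hT s hs)
  let φ : Ordinal.{u} → ZFSet.{u} := fun a =>
    insert (ZFSet.pair (nat l) a.toZFSet) (seg g l)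
  have hφ : Function.Injective φ := by
    intro a b hab
    have h : ZFSet.pair (nat l) a.toZFSet ∈ φ b := hab ▸ ZFSet.mem_insert _ _
    rcases ZFSet.mem_insert_iff.1 h with h | h
    · exact Ordinal.toZFSet_injective (ZFSet.pair_inj.1 h).2
    · exact absurd h pair_notMem_seg
  let X : Set Ordinal.{u} := {a | a < Ordinal.omega 1 ∧ φ a ∈ T}
  have himage : (treeSucc T (seg g l) : Set ZFSet.{u}) = φ '' X := by
    ext t
    rw [SetLike.mem_coe, mem_treeSucc_seg hg]
    constructor
    · rintro ⟨ht, ξ, hξ, rfl⟩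
      obtain ⟨a, ha, rfl⟩ := Ordinal.mem_toZFSet_iff.1 hξ
      exact ⟨a, ⟨ha, ht⟩, rfl⟩
    · rintro ⟨a, ⟨ha, ht⟩, rfl⟩
      exact ⟨ht, _, Ordinal.mem_toZFSet_iff.2 ⟨a, ha, rfl⟩, rfl⟩
  have hcard : (treeSucc T (seg g l)).card = ℵ_ 1 ↔ #X = ℵ_ 1 := by
    have h1 : #(treeSucc T (seg g l)) = #X := by
      rw [← mk_image_eq hφ, ← himage]
      rfl
    rw [← h1, ZFSet.cardinalMk_coe_sort, ← lift_inj.{u, u + 1}]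
    simp
  have hmem : ∀ a : Ordinal.{u}, a < Ordinal.omega 1 →
      (a ∈ X ↔ ∃ r ∈ T, IsLastValue T (seg g l) r a.toZFSet) := by
    intro a ha
    have ha' : a.toZFSet ∈ omegaOne := Ordinal.mem_toZFSet_iff.2 ⟨a, ha, rfl⟩
    constructor
    · rintro ⟨_, h⟩
      exact ⟨_, h, h, nat l, nat_mem_omega l, (oneStep_seg_iff (hT _ h)).2 ⟨ha', rfl, rfl⟩⟩
    · rintro ⟨r, hr, _, n, _, h⟩
      obtain ⟨_, _, rfl⟩ := (oneStep_seg_iff (hT _ hr)).1 h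
      exact ⟨ha, hr⟩
  rw [hcard, mk_eq_aleph_one_iff fun a ha => ha.1]
  constructor
  · intro h α hα
    obtain ⟨a, ha, rfl⟩ := Ordinal.mem_toZFSet_iff.1 hα
    obtain ⟨b, hb, hab⟩ := h a ha
    exact ⟨_, Ordinal.mem_toZFSet_iff.2 ⟨b, hb.1, rfl⟩, Ordinal.toZFSet_mem_toZFSet_iff.2 hab,
      (hmem b hb.1).1 hb⟩
  · intro h a ha
    obtain ⟨ξ, hξ, haξ, hr⟩ := h _ (Ordinal.mem_toZFSet_iff.2 ⟨a, ha, rfl⟩)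
    obtain ⟨b, hb, rfl⟩ := Ordinal.mem_toZFSet_iff.1 hξ
    exact ⟨b, (hmem b hb).2 hr, Ordinal.toZFSet_mem_toZFSet_iff.1 haξ⟩

/-- In this form every quantifier is bounded by `T` or by one of the parameters `Str`, `ω_1`. -/
theorem mem_WT_iff : T ∈ WT ↔ (∀ s ∈ T, s ∈ Str) ∧
    (∀ s ∈ T, ∀ t ∈ Str.{u}, t ⊆ s → t ∈ T) ∧ (∃ s ∈ T, True) ∧
    (∀ s ∈ T, ∃ t ∈ T, (∃ r ∈ T, ∃ r' ∈ T, (∃ ξ ∈ omegaOne, IsLastValue T t r ξ) ∧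
      (∃ ξ ∈ omegaOne, IsLastValue T t r' ξ) ∧ r ≠ r') ∧ s ⊆ t) ∧
    ∀ t ∈ T, (∃ r ∈ T, ∃ r' ∈ T, (∃ ξ ∈ omegaOne, IsLastValue T t r ξ) ∧
      (∃ ξ ∈ omegaOne, IsLastValue T t r' ξ) ∧ r ≠ r') →
      ∀ α ∈ omegaOne, ∃ ξ ∈ omegaOne, α ∈ ξ ∧ ∃ r ∈ T, IsLastValue T t r ξ := by
  have hne : T.Nonempty ↔ ∃ s ∈ T, True := by simp [ZFSet.nonempty_def]
  constructor
  · rintro ⟨⟨h1, h2⟩, h3, h4, h5⟩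
    simp only [isBranchingNode_iff h1] at h4 h5
    refine ⟨fun s hs => mem_Str.2 (h1 s hs), fun s hs t ht => h2 s hs t (mem_Str.1 ht),
      hne.1 h3, fun s hs => ?_, fun t ht hb => (card_treeSucc_iff h1 ht).1 (h5 t ⟨ht, hb⟩)⟩
    obtain ⟨t, ⟨ht, hb⟩, hst⟩ := h4 s hs
    exact ⟨t, ht, hb, hst⟩
  · rintro ⟨h1, h2, h3, h4, h5⟩
    have h1' : ∀ s ∈ T, IsString omegaOne s := fun s hs => mem_Str.1 (h1 s hs)
    refine ⟨⟨h1', fun s hs t ht => h2 s hs t (mem_Str.2 ht)⟩, hne.2 h3, fun s hs => ?_,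
      fun t ht => ?_⟩
    · obtain ⟨t, ht, hb, hst⟩ := h4 s hs
      exact ⟨t, (isBranchingNode_iff h1').2 ⟨ht, hb⟩, hst⟩
    · obtain ⟨ht, hb⟩ := (isBranchingNode_iff h1').1 ht
      exact (card_treeSucc_iff h1' ht).2 (h5 t ht hb)

theorem mem_Homega2_of_mem_WT (hT : T ∈ WT) : T ∈ Homega2 :=
  mem_Homega2_of_subset Str_mem_Homega2 fun s hs => mem_Str.2 (hT.1.1 s hs)

theorem exists_isBranch (hT : T ∈ WT) (hs : s ∈ T) : ∃ x, IsBranch T x ∧ s ⊆ x := by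
  have hstep : ∀ s ∈ T, ∃ t ∈ T, s ⊆ t ∧ s ≠ t := by
    intro s hs
    obtain ⟨-, -, -, h, -⟩ := mem_WT_iff.1 hT
    -- The branching node `t` may be `s` itself, so a successor `r` of `t` is taken.
    obtain ⟨t, ht, ⟨r, hr, -, -, ⟨ξ, -, -, n, -, htr, p, hp, -, hpt, -⟩, -⟩, hst⟩ := h s hs
    exact ⟨r, hr, fun _ h => htr (hst h), fun he => hpt (hst (he ▸ hp))⟩
  choose! f hf hsub hne using hstep
  have hmem : ∀ k, f^[k] s ∈ T := by
    intro k
    induction k with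
    | zero => exact hs
    | succ k ih => rw [Function.iterate_succ_apply']; exact hf _ ih
  obtain ⟨g, hg, h⟩ := exists_graph_of_chain (s := fun k => f^[k] s)
    (fun k => hT.1.1 _ (hmem k))
    (fun k => by simpa only [Function.iterate_succ_apply'] using hsub _ (hmem k))
    (fun k => by simpa only [Function.iterate_succ_apply'] using hne _ (hmem k))
  refine ⟨graph g, ⟨isFunc_omega_iff.2 ⟨g, hg, rfl⟩, fun m hm => ?_⟩, (h 0).1⟩
  obtain ⟨m, rfl⟩ := mem_omega.1 hm
  rw [restr_graph]
  exact hT.1.2 _ (hmem m) _ (isString_seg fun i _ => hg i) (h m).2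

/-- The elimination of branches. A node deciding all values below `m` lies on some branch
(`exists_isBranch`), whose values it determines; conversely every branch has a segment in `T`
deciding them (`exists_seg_decides`). Nodes too short to decide satisfy the first alternative. -/
theorem forall_isBranch_iff {N : ℕ} {e : Fin N → ZFSet.{u}} (he : ∀ j, e j ∈ CCF Θ)
    (hT : T ∈ WT) (Q : Set (Fin N → ZFSet.{u})) :
    (∀ x, IsBranch T x → ∀ m ∈ ZFSet.omega.{u}, (fun j => restr (codeFun Θ (e j) x) m) ∈ Q) ↔
    ∃ D ∈ Homega2, ∀ s ∈ T, ∀ m ∈ ZFSet.omega.{u}, (∃ j, ∃ i ∈ m, ¬ Decides (e j) s i) ∨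
      ∃ w : Fin N → ZFSet.{u}, (∀ j, w j ∈ D) ∧ ((∀ j, IsDecided (e j) s m (w j)) ∧ w ∈ Q) := by
  have hpre := fun j => (mem_CCF_iff.1 (he j)).1
  constructor
  · intro h
    -- A single transitive set in `H_{ω_2}` contains all values of all the codes, so the strings
    -- over it serve as `D` for every `s` and `m`.
    set B := transClosure (ZFSet.range fun j : ULift.{u} (Fin N) => e j.down) with hBdef
    have hB : B ∈ Homega2 := transClosure_mem_Homega2 <| range_mem_Homega2
      ((mk_lt_aleph0).trans_le (aleph0_le_aleph 2)) fun j => mem_Homega2_of_mem_CCF_Theta (he _)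
    have hval : ∀ j t i ξ, Entry (e j) t i ξ → ξ ∈ B := by
      intro j t i ξ h
      have htr := isTransitive_transClosure (ZFSet.range fun j : ULift.{u} (Fin N) => e j.down)
      have h0 : e j ∈ B := subset_transClosure _ (ZFSet.mem_range.2 ⟨⟨j⟩, rfl⟩)
      have h1 := htr.subset_of_mem h0 h
      have h2 : ({ZFSet.pair t i, ξ} : ZFSet) ∈ B := htr.subset_of_mem h1 (by simp [ZFSet.pair])
      exact htr.subset_of_mem h2 (by simp)
    refine ⟨strSet B, strSet_mem_Homega2 hB, fun s hs m hm => ?_⟩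
    by_cases hd : ∃ j, ∃ i ∈ m, ¬ Decides (e j) s i
    · exact .inl hd
    · push Not at hd
      obtain ⟨x, hx, hsx⟩ := exists_isBranch hT hs
      refine .inr ⟨_, fun j => ?_, fun j => ?_, h x hx m hm⟩
      · exact mem_strSet.2 (isString_restr_codeFun (he j) hx.1 hm (hval j))
      · exact (isDecided_iff (hpre j) hx.1 hsx (hd j)).2 rfl
  · rintro ⟨D, _, h⟩ x hx m hm
    obtain ⟨g, hg, rfl⟩ := isFunc_omega_iff.1 hx.1
    obtain ⟨l, hl⟩ := exists_seg_decides he hg hm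
    have hlT : seg g l ∈ T := restr_graph (g := g) ▸ hx.2 (nat l) (nat_mem_omega l)
    rcases h _ hlT m hm with ⟨j, i, hi, hn⟩ | ⟨w, _, hw, hQ⟩
    · exact absurd (hl j i hi) hn
    · convert! hQ using 1
      funext j
      exact ((isDecided_iff (hpre j) hx.1 (seg_subset_graph_self g l) (hl j)).1 (hw j)).symm

end trees

/-! ### Complexity of the basic notions over `H_{ω_2}`. -/

theorem Tm.ev_some {ι : Type*} (t : Tm.{u} ι) (w : Option ι → ZFSet.{u}) :
    t.ev (fun i => w (some i)) = (t.map some).ev w := t.ev_comp some w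

/-- The constant term `ω`. -/
noncomputable def Tm.omega {ι : Type*} : Tm.{u} ι := .const ZFSet.omega omega_mem_Homega2

/-- The constant term `ω_1`. -/
noncomputable def Tm.omegaOne {ι : Type*} : Tm.{u} ι := .const WideTrees.omegaOne omegaOne_mem_Homega2

/-- The constant term for the set of all strings. -/
noncomputable def Tm.str {ι : Type*} : Tm.{u} ι := .const Str Str_mem_Homega2

section
variable {ι : Type}

/-- Proves that relations built from `∈` and `=` by connectives and bounded quantifiers are
bounded definable. -/
theorem D0.of_bounded {P : (ι → ZFSet.{u}) → Prop} (h : D0 P := by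
    repeat' first
      | with_reducible exact D0.eq _ _
      | with_reducible exact D0.mem _ _
      | with_reducible refine D0.and ?_ ?_
      | with_reducible refine D0.or ?_ ?_
      | with_reducible refine D0.not ?_
      | (with_reducible refine D0.bex _ ?_; try simp only [Tm.ev_some])
      | (with_reducible refine D0.ball _ ?_; try simp only [Tm.ev_some])
      | with_reducible refine D0.imp ?_ ?_) : D0 P := h

theorem D0.subset (s t : Tm.{u} ι) : D0 (fun v => s.ev v ⊆ t.ev v) :=
  D0.of_bounded (P := fun v => ∀ y ∈ s.ev v, y ∈ t.ev v)

theorem eq_unordered_pair_iff {z x y : ZFSet.{u}} :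
    z = {x, y} ↔ x ∈ z ∧ y ∈ z ∧ ∀ w ∈ z, w = x ∨ w = y := by
  constructor
  · rintro rfl
    simp
  · rintro ⟨hx, hy, h⟩
    ext w
    rw [ZFSet.mem_pair]
    refine ⟨h w, ?_⟩
    rintro (rfl | rfl)
    exacts [hx, hy]

theorem D0.eq_unordered_pair (z x y : Tm.{u} ι) :
    D0 (fun v => z.ev v = ({x.ev v, y.ev v} : ZFSet.{u})) := by
  simp only [eq_unordered_pair_iff]
  exact D0.of_bounded

theorem eq_pair_iff {p x y : ZFSet.{u}} : p = ZFSet.pair x y ↔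
    (∃ z ∈ p, z = {x, x}) ∧ (∃ z ∈ p, z = {x, y}) ∧ ∀ z ∈ p, z = {x, x} ∨ z = {x, y} := by
  rw [ZFSet.pair, eq_unordered_pair_iff]
  simp

theorem D0.eq_pair (p x y : Tm.{u} ι) : D0 (fun v => p.ev v = ZFSet.pair (x.ev v) (y.ev v)) := by
  simp only [eq_pair_iff]
  refine .and (.bex _ ?_) (.and (.bex _ ?_) (.ball _ (.or ?_ ?_))) <;>
  · simp only [Tm.ev_some]
    exact .eq_unordered_pair _ _ _

/-- The second component of a Kuratowski pair is an element of an element of the pair, so the search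
for `ξ` is bounded by `f`. -/
theorem exists_pair_mem_iff {f i : ZFSet.{u}} {P : ZFSet.{u} → Prop} :
    (∃ ξ, ZFSet.pair i ξ ∈ f ∧ P ξ) ↔ ∃ p ∈ f, ∃ z ∈ p, ∃ ξ ∈ z, p = ZFSet.pair i ξ ∧ P ξ := by
  constructor
  · rintro ⟨ξ, h, hP⟩
    exact ⟨_, h, {i, ξ}, by simp [ZFSet.pair], ξ, by simp, rfl, hP⟩
  · rintro ⟨p, hp, z, _, ξ, _, rfl, hP⟩
    exact ⟨ξ, hp, hP⟩

theorem D0.exists_pair_mem (f i : Tm.{u} ι) {P : (ι → ZFSet.{u}) → ZFSet.{u} → Prop}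
    (h : D0 (fun w : Option ι → ZFSet.{u} => P (fun i => w (some i)) ((Tm.var none).ev w))) :
    D0 (fun v => ∃ ξ, ZFSet.pair (i.ev v) ξ ∈ f.ev v ∧ P v ξ) := by
  simp only [exists_pair_mem_iff]
  iterate 3
    refine .bex _ ?_
    simp only [Tm.ev_some]
  refine .and (.eq_pair _ _ _) ?_
  exact h.comp (fun o : Option ι => o.elim none fun i => some (some (some i)))

theorem D0.forall_pair_mem (f i : Tm.{u} ι) {P : (ι → ZFSet.{u}) → ZFSet.{u} → Prop}
    (h : D0 (fun w : Option ι → ZFSet.{u} => P (fun i => w (some i)) ((Tm.var none).ev w))) :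
    D0 (fun v => ∀ ξ, ZFSet.pair (i.ev v) ξ ∈ f.ev v → P v ξ) := by
  refine (D0.exists_pair_mem f i (P := fun v ξ => ¬ P v ξ) h.not).not.congr fun v _ => ?_
  push Not
  rfl

/-- The inner pair is named as `a` first, because `D0.eq_pair` speaks of terms only. -/
theorem exists_entry_iff {c s i : ZFSet.{u}} {P : ZFSet.{u} → Prop} :
    (∃ ξ, Entry c s i ξ ∧ P ξ) ↔ ∃ p ∈ c, ∃ z ∈ p, ∃ a ∈ z, a = ZFSet.pair s i ∧
      ∃ z ∈ p, ∃ ξ ∈ z, p = ZFSet.pair a ξ ∧ P ξ := by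
  constructor
  · rintro ⟨ξ, h, hP⟩
    exact ⟨_, h, {ZFSet.pair s i, ξ}, by simp [ZFSet.pair], _, by simp, rfl,
      {ZFSet.pair s i, ξ}, by simp [ZFSet.pair], ξ, by simp, rfl, hP⟩
  · rintro ⟨p, hp, z, _, a, _, rfl, z', _, ξ, _, rfl, hP⟩
    exact ⟨ξ, hp, hP⟩

theorem D0.exists_entry (c s i : Tm.{u} ι) {P : (ι → ZFSet.{u}) → ZFSet.{u} → Prop}
    (h : D0 (fun w : Option ι → ZFSet.{u} => P (fun i => w (some i)) ((Tm.var none).ev w))) :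
    D0 (fun v => ∃ ξ, Entry (c.ev v) (s.ev v) (i.ev v) ξ ∧ P v ξ) := by
  simp only [exists_entry_iff]
  iterate 3
    refine .bex _ ?_
    simp only [Tm.ev_some]
  refine .and (.eq_pair _ _ _) ?_
  iterate 2
    refine .bex _ ?_
    simp only [Tm.ev_some]
  refine .and (.eq_pair _ _ _) ?_
  exact h.comp (fun o : Option ι => o.elim none fun i => some (some (some (some (some i)))))

theorem D0.forall_entry (c s i : Tm.{u} ι) {P : (ι → ZFSet.{u}) → ZFSet.{u} → Prop}
    (h : D0 (fun w : Option ι → ZFSet.{u} => P (fun i => w (some i)) ((Tm.var none).ev w))) :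
    D0 (fun v => ∀ ξ, Entry (c.ev v) (s.ev v) (i.ev v) ξ → P v ξ) := by
  refine (D0.exists_entry c s i (P := fun v ξ => ¬ P v ξ) h.not).not.congr fun v _ => ?_
  push Not
  rfl

theorem D0.decides (c s i : Tm.{u} ι) : D0 (fun v => Decides (c.ev v) (s.ev v) (i.ev v)) := by
  refine (D0.bex Tm.str (P := fun v t => t ⊆ s.ev v ∧ ∃ ξ, Entry (c.ev v) t (i.ev v) ξ ∧ True)
    ?_).congr fun v _ => ?_
  · simp only [Tm.ev_some]
    exact .and (.subset _ _) (.exists_entry _ _ _ .trivial)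
  · simp only [and_true]
    rfl

/-- Proves that relations built from the basic notions about pairs and codes are bounded
definable. -/
theorem D0.of_coded {P : (ι → ZFSet.{u}) → Prop} (h : D0 P := by
    repeat' first
      | with_reducible exact D0.trivial
      | with_reducible exact D0.eq _ _
      | with_reducible exact D0.mem _ _
      | with_reducible exact D0.subset _ _
      | with_reducible exact D0.eq_pair _ _ _
      | with_reducible exact D0.decides _ _ _
      | apply_assumption
      | with_reducible refine D0.and ?_ ?_
      | with_reducible refine D0.or ?_ ?_
      | with_reducible refine D0.not ?_
      | (with_reducible refine D0.exists_pair_mem _ _ ?_; try simp only [Tm.ev_some])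
      | (with_reducible refine D0.forall_pair_mem _ _ ?_; try simp only [Tm.ev_some])
      | (with_reducible refine D0.exists_entry _ _ _ ?_; try simp only [Tm.ev_some])
      | (with_reducible refine D0.forall_entry _ _ _ ?_; try simp only [Tm.ev_some])
      | (with_reducible refine D0.bex _ ?_; try simp only [Tm.ev_some])
      | (with_reducible refine D0.ball _ ?_; try simp only [Tm.ev_some])
      | with_reducible refine D0.imp ?_ ?_) : D0 P := h

theorem D0.mem_Theta (t : Tm.{u} ι) : D0 (fun v => t.ev v ∈ Θ) := by
  refine (D0.of_bounded (P := fun v => (∀ x ∈ t.ev v, ∀ y ∈ x, y ∈ t.ev v) ∧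
    ∀ x ∈ t.ev v, ∀ y ∈ x, ∀ z ∈ y, z ∈ x)).congr fun v hv => ?_
  rw [WideTrees.mem_Theta, ZFSet.isOrdinal_iff_forall_mem_isTransitive]
  exact ⟨fun h => ⟨h, t.ev_mem hv⟩, fun h => h.1⟩

theorem D0.mem_omega (t : Tm.{u} ι) : D0 (fun v => t.ev v ∈ ZFSet.omega) := D0.mem t .omega

theorem isFunc_iff {x ϑ f : ZFSet.{u}} : ZFSet.IsFunc x ϑ f ↔
    (∀ p ∈ f, ∃ i ∈ x, ∃ ξ, ZFSet.pair i ξ ∈ f ∧ (ξ ∈ ϑ ∧ p = ZFSet.pair i ξ)) ∧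
    ∀ i ∈ x, ∃ ξ, ZFSet.pair i ξ ∈ f ∧ ∀ η, ZFSet.pair i η ∈ f → η = ξ := by
  refine and_congr ?_ Iff.rfl
  constructor
  · intro h p hp
    obtain ⟨i, hi, ξ, hξ, rfl⟩ := ZFSet.mem_prod.1 (h hp)
    exact ⟨i, hi, ξ, hp, hξ, rfl⟩
  · intro h p hp
    obtain ⟨i, hi, ξ, _, hξ, rfl⟩ := h p hp
    exact ZFSet.pair_mem_prod.2 ⟨hi, hξ⟩

theorem D0.isFunc {ϑ : ZFSet.{u}} (hϑ : ∀ {κ : Type} (t : Tm.{u} κ), D0 (fun v => t.ev v ∈ ϑ))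
    (x f : Tm.{u} ι) : D0 (fun v => ZFSet.IsFunc (x.ev v) ϑ (f.ev v)) := by
  simp only [isFunc_iff]
  exact .of_coded

theorem D0.isString {ϑ : ZFSet.{u}} (hϑ : ∀ {κ : Type} (t : Tm.{u} κ), D0 (fun v => t.ev v ∈ ϑ))
    (s : Tm.{u} ι) : D0 (fun v => IsString ϑ (s.ev v)) := by
  refine D0.bex Tm.omega (P := fun v m => ZFSet.IsFunc m ϑ (s.ev v)) ?_
  simp only [Tm.ev_some]
  exact .isFunc hϑ _ _

theorem D0.isPrecode {ϑ : ZFSet.{u}} (hϑ : ∀ {κ : Type} (t : Tm.{u} κ), D0 (fun v => t.ev v ∈ ϑ))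
    (c : Tm.{u} ι) : D0 (fun v => IsPrecode ϑ (c.ev v)) := by
  refine (D0.of_coded (P := fun v => (∀ p ∈ c.ev v, ∃ s ∈ Tm.str.ev v, ∃ i ∈ Tm.omega.ev v,
    ∃ ξ, Entry (c.ev v) s i ξ ∧ (ξ ∈ ϑ ∧ ∃ z ∈ p, ∃ a ∈ z, a = ZFSet.pair s i ∧
      p = ZFSet.pair a ξ)) ∧
    ∀ i ∈ Tm.omega.ev v, ∀ s ∈ Tm.str.ev v, ∀ t ∈ Tm.str.ev v, (s ⊆ t ∨ t ⊆ s) →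
      ∀ ξ, Entry (c.ev v) s i ξ → ∀ η, Entry (c.ev v) t i η → ξ = η)).congr fun v _ => ?_
  refine and_congr (forall₂_congr fun p _ => exists_congr fun s => and_congr_right fun _ =>
    exists_congr fun i => and_congr_right fun _ => exists_congr fun ξ => and_congr_right fun _ =>
    and_congr_right fun _ => ?_) Iff.rfl
  constructor
  · rintro ⟨z, _, a, _, rfl, h⟩
    exact h
  · rintro rfl
    exact ⟨{ZFSet.pair s i, ξ}, by simp [ZFSet.pair], _, by simp, rfl, rfl⟩

theorem D0.isRanking (c F : Tm.{u} ι) : D0 (fun v => IsRanking (c.ev v) (F.ev v)) := by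
  refine (D0.of_coded (P := fun v => ∀ i ∈ Tm.omega.ev v, ∀ s ∈ Tm.str.ev v,
    Decides (c.ev v) s i ∨ ((∃ a, Entry (F.ev v) s i a ∧ True) ∧ ∀ t ∈ Tm.str.ev v, s ⊆ t →
      ¬ s = t → ¬ Decides (c.ev v) t i →
      ∀ a, Entry (F.ev v) s i a → ∀ b, Entry (F.ev v) t i b → b ∈ a))).congr fun v _ => ?_
  simp only [and_true]
  rfl

theorem D0.isDecided (c s m w : Tm.{u} ι) :
    D0 (fun v => IsDecided (c.ev v) (s.ev v) (m.ev v) (w.ev v)) := by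
  refine (D0.of_coded (P := fun v => (∀ p ∈ w.ev v, ∃ i ∈ m.ev v, ∃ t ∈ Tm.str.ev v,
      t ⊆ s.ev v ∧ ∃ ξ, Entry (c.ev v) t i ξ ∧ p = ZFSet.pair i ξ) ∧
    ∀ i ∈ m.ev v, ∀ t ∈ Tm.str.ev v, t ⊆ s.ev v → ∀ ξ, Entry (c.ev v) t i ξ →
      ∃ p ∈ w.ev v, p = ZFSet.pair i ξ)).congr fun v _ => ?_
  simp only [exists_eq_right]
  rfl

theorem D0.mem_WT (T : Tm.{u} ι) : D0 (fun v => T.ev v ∈ WT) := by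
  have hlast : ∀ {κ : Type} (T s t ξ : Tm.{u} κ),
      D0 (fun v => IsLastValue (T.ev v) (s.ev v) (t.ev v) (ξ.ev v)) := by
    intro κ T s t ξ
    exact D0.of_coded (P := fun v => t.ev v ∈ T.ev v ∧ ∃ n ∈ Tm.omega.ev v, s.ev v ⊆ t.ev v ∧
      ∃ p ∈ t.ev v, p = ZFSet.pair n (ξ.ev v) ∧ ¬ p ∈ s.ev v ∧
        ∀ q ∈ t.ev v, q ∈ s.ev v ∨ q = p)
  refine (D0.of_coded (P := fun v => (∀ s ∈ T.ev v, s ∈ Tm.str.ev v) ∧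
    (∀ s ∈ T.ev v, ∀ t ∈ Tm.str.ev v, t ⊆ s → t ∈ T.ev v) ∧ (∃ s ∈ T.ev v, True) ∧
    (∀ s ∈ T.ev v, ∃ t ∈ T.ev v, (∃ r ∈ T.ev v, ∃ r' ∈ T.ev v,
      (∃ ξ ∈ Tm.omegaOne.ev v, IsLastValue (T.ev v) t r ξ) ∧
      (∃ ξ ∈ Tm.omegaOne.ev v, IsLastValue (T.ev v) t r' ξ) ∧ ¬ r = r') ∧ s ⊆ t) ∧
    ∀ t ∈ T.ev v, (∃ r ∈ T.ev v, ∃ r' ∈ T.ev v,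
      (∃ ξ ∈ Tm.omegaOne.ev v, IsLastValue (T.ev v) t r ξ) ∧
      (∃ ξ ∈ Tm.omegaOne.ev v, IsLastValue (T.ev v) t r' ξ) ∧ ¬ r = r') →
      ∀ α ∈ Tm.omegaOne.ev v, ∃ ξ ∈ Tm.omegaOne.ev v, α ∈ ξ ∧
        ∃ r ∈ T.ev v, IsLastValue (T.ev v) t r ξ)).congr fun v _ => ?_
  exact mem_WT_iff.symm

/-- The definition gives the `Π_1` form, as `ω_1^ω` is included in `H_{ω_2}`; existence of a ranking
gives the `Σ_1` form. -/
theorem Lev.mem_CCF {ϑ : ZFSet.{u}}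
    (hϑ : ∀ {κ : Type} (t : Tm.{u} κ), D0 (fun v => t.ev v ∈ ϑ)) (b : Bool) (c : Tm.{u} ι) :
    Lev b 1 (fun v => c.ev v ∈ CCF ϑ) := by
  have hpre := (D0.isPrecode hϑ c)
  cases b
  · have h : Lev false 1 (fun v => ∀ x ∈ Homega2, ZFSet.IsFunc ZFSet.omega omegaOne.{u} x →
        ∀ i ∈ ZFSet.omega.{u}, Decides (c.ev v) x i) := by
      refine Lev.all (D0.lev_of ?_)
      simp only [Tm.ev_some]
      refine .imp (.isFunc (fun t => .mem t .omegaOne) .omega _) ?_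
      exact D0.of_coded (P := fun v : Option ι → ZFSet.{u} => ∀ i ∈ Tm.omega.ev v,
        Decides ((c.map some).ev v) ((Tm.var none).ev v) i)
    refine (hpre.lev_of.and h).congr fun v _ => ?_
    rw [mem_CCF_iff]
    refine and_congr_right fun _ => ⟨fun H x hx => ?_, fun H x _ => H x⟩
    exact H x (isFunc_omega_mem_Homega2 omegaOne_mem_Homega2 hx) hx
  · have h : Lev true 1 (fun v => ∃ F ∈ Homega2, IsRanking (c.ev v) F) := by
      refine Lev.ex (D0.lev_of ?_)
      simp only [Tm.ev_some]
      exact .isRanking _ _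
    exact (hpre.lev_of.and h).congr fun v _ => mem_CCF_iff_exists_isRanking.symm

theorem D0.forces_matrix {N : ℕ} {Q : Set (Fin N → ZFSet.{u})} (hQ : D0 (fun w => w ∈ Q))
    (T D : Tm.{u} ι) (e : Fin N → Tm.{u} ι) :
    D0 (fun v => ∀ s ∈ T.ev v, ∀ m ∈ ZFSet.omega.{u},
      (∃ j, ∃ i ∈ m, ¬ Decides ((e j).ev v) s i) ∨
      ∃ w : Fin N → ZFSet.{u}, (∀ j, w j ∈ D.ev v) ∧
        ((∀ j, IsDecided ((e j).ev v) s m (w j)) ∧ w ∈ Q)) := by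
  refine D0.ball T ?_
  simp only [Tm.ev_some]
  refine D0.ball .omega (P := fun v m => (∃ j, ∃ i ∈ m, ¬ Decides (((e j).map some).ev v)
      ((Tm.var none).ev v) i) ∨ ∃ w : Fin N → ZFSet.{u}, (∀ j, w j ∈ (D.map some).ev v) ∧
        ((∀ j, IsDecided (((e j).map some).ev v) ((Tm.var none).ev v) m (w j)) ∧ w ∈ Q)) ?_
  simp only [Tm.ev_some]
  refine .or (.exists_fin fun j => .of_coded) (.bexFin _ (.and (.forall_fin fun j => ?_) ?_))
  · simp only [Tm.ev_comp]
    exact .isDecided _ _ _ (.var (Sum.inr j))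
  · exact hQ.comp Sum.inr

end

/-! ### Complexity of forcing, by induction on formulas. -/

theorem Lev.succ_not {b : Bool} {k : ℕ} {ι : Type*} {P : (ι → ZFSet.{u}) → Prop} (h : Lev b k P) :
    Lev (!b) (k + 1) P := by
  obtain ⟨m, ψ, t, hψ, H⟩ := h
  cases b
  exacts [⟨m, ψ, t, .ofPi hψ, H⟩, ⟨m, ψ, t, .ofSigma hψ, H⟩]

theorem LFormula.two_le {b : Bool} {k n : ℕ} (φ : LFormula.{u} b k n) : 2 ≤ k := by
  induction φ <;> omega

theorem D0.mem_stringTuples (n : ℕ) : D0 (fun v => v ∈ stringTuples.{u} n) :=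
  .and (.isString .mem_Theta (.var 0)) (.forall_fin fun i => .isString .mem_omega (.var i.succ))

theorem D0.of_isSigma_zero {n : ℕ} {Q : Set (Fin n → ZFSet.{u})} (h : IsSigma Homega2 0 Q) :
    D0 (fun v => v ∈ Q) := by
  obtain ⟨r, φ, p, hφ, hp, rfl⟩ := h
  exact (Lev.of_definedRel hφ hp).d0

theorem mem_Homega2_of_mem_stringTuples {n : ℕ} {v : Fin (n + 2) → ZFSet.{u}}
    (hv : v ∈ stringTuples n) (i : Fin (n + 2)) : v i ∈ Homega2 := by
  refine Fin.cases ?_ (fun i => ?_) i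
  · obtain ⟨g, l, hg, he⟩ := isString_iff.1 hv.1
    -- As `Θ` is not in `H_{ω_2}`, the string is viewed over the finite set of its own values.
    have hB : ZFSet.range (fun i : ULift.{u} (Fin l) => g i.down) ∈ Homega2 :=
      range_mem_Homega2 (Cardinal.mk_lt_aleph0.trans_le (Cardinal.aleph0_le_aleph 2)) fun i =>
        (WideTrees.mem_Theta.1 (hg i.down i.down.2)).2
    refine isString_mem_Homega2 hB ?_
    rw [he]
    exact isString_seg fun i hi => ZFSet.mem_range.2 ⟨⟨⟨i, hi⟩⟩, rfl⟩
  · exact isString_mem_Homega2 omega_mem_Homega2 (hv.2 i)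

/-- The relative complement stays bounded because `stringTuples` is itself bounded definable; this
keeps the dual formula legal. -/
theorem isSigma_zero_compl {n : ℕ} {Q : Set (Fin (n + 2) → ZFSet.{u})}
    (h : IsSigma Homega2 0 Q) : IsSigma Homega2 0 (stringTuples n \ Q) :=
  Lev.exists_formula (((D0.mem_stringTuples n).and (D0.of_isSigma_zero h).not).lev)
    fun _ hv => mem_Homega2_of_mem_stringTuples hv.1

theorem LFormula.IsLegal.dual {b : Bool} {k n : ℕ} {φ : LFormula.{u} b k n} (h : φ.IsLegal) :
    φ.dual.IsLegal := by
  induction φ with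
  | sigma2 Q => exact ⟨Set.sdiff_subset, isSigma_zero_compl h.2⟩
  | pi2 Q => exact ⟨Set.sdiff_subset, isSigma_zero_compl h.2⟩
  | ex ψ ih => exact ih h
  | all ψ ih => exact ih h

/-- The tuple consists of a wide tree and codes of functions into `ω^ω`. -/
def IsForcArgs {n : ℕ} (v : Fin (n + 1) → ZFSet.{u}) : Prop :=
  v 0 ∈ WT ∧ ∀ i : Fin n, v i.succ ∈ CCF ZFSet.omega

theorem IsForcArgs.mem_Homega2 {n : ℕ} {v : Fin (n + 1) → ZFSet.{u}} (hv : IsForcArgs v)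
    (i : Fin (n + 1)) : v i ∈ Homega2 :=
  Fin.cases (mem_Homega2_of_mem_WT hv.1) (fun i => mem_Homega2_of_mem_CCF_omega (hv.2 i)) i

theorem mem_Forc_iff {b : Bool} {k n : ℕ} {φ : LFormula.{u} b k n} {v : Fin (n + 1) → ZFSet.{u}} :
    v ∈ Forc φ ↔ IsForcArgs v ∧ Forces φ (v 0) (fun i => v i.succ) :=
  and_assoc.symm

theorem Lev.isForcArgs (b : Bool) (n : ℕ) :
    Lev b 1 (fun v : Fin (n + 1) → ZFSet.{u} => IsForcArgs v) :=
  (D0.mem_WT (.var 0)).lev_of.and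
    (Lev.forall_fin fun i => Lev.mem_CCF D0.mem_omega b (.var i.succ))

/-- All codes are viewed as members of `CCF Θ`, so that `forall_isBranch_iff` applies to the whole
tuple; `c`, `d` and `D` are then the only unbounded quantifiers outside the `CCF` conditions. -/
theorem forces_sigma2_iff {n : ℕ} {Q : Set (Fin (n + 2) → ZFSet.{u})} {T : ZFSet.{u}}
    {cs : Fin n → ZFSet.{u}} (hT : T ∈ WT) (hcs : ∀ i, cs i ∈ CCF ZFSet.omega) :
    Forces (.sigma2 Q) T cs ↔ ∃ c ∈ Homega2, c ∈ CCF ZFSet.omega.{u} ∧ ∃ d ∈ Homega2,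
      d ∈ CCF Θ.{u} ∧ ∃ D ∈ Homega2, ∀ s ∈ T, ∀ m ∈ ZFSet.omega.{u},
        (∃ j, ∃ i ∈ m, ¬ Decides ((Fin.cons d (Fin.cons c cs : Fin (n + 1) → ZFSet.{u}) :
          Fin (n + 2) → ZFSet.{u}) j) s i) ∨
        ∃ w : Fin (n + 2) → ZFSet.{u}, (∀ j, w j ∈ D) ∧
          ((∀ j, IsDecided ((Fin.cons d (Fin.cons c cs : Fin (n + 1) → ZFSet.{u}) :
            Fin (n + 2) → ZFSet.{u}) j) s m (w j)) ∧ w ∈ Q) := by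
  have key : ∀ c ∈ CCF ZFSet.omega.{u}, ∀ d ∈ CCF Θ.{u}, (∀ x, IsBranch T x →
      ∀ m ∈ ZFSet.omega.{u}, (Fin.cons (restr (codeFun Θ d x) m)
          (Fin.cons (restr (codeFun ZFSet.omega c x) m)
            (fun i => restr (codeFun ZFSet.omega (cs i) x) m) : Fin (n + 1) → ZFSet.{u}) :
          Fin (n + 2) → ZFSet.{u}) ∈ Q) ↔
      ∀ x, IsBranch T x → ∀ m ∈ ZFSet.omega.{u}, (fun j => restr (codeFun Θ
        ((Fin.cons d (Fin.cons c cs : Fin (n + 1) → ZFSet.{u}) : Fin (n + 2) → ZFSet.{u}) j) x) m)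
          ∈ Q := by
    intro c hc d _
    have heq : ∀ e ∈ CCF ZFSet.omega.{u}, ∀ x, IsBranch T x → ∀ m,
        restr (codeFun ZFSet.omega e x) m = restr (codeFun Θ e x) m := fun e he x hx m =>
      restr_codeFun_eq_of_subset (mem_CCF_iff.1 he).1 omega_subset_Theta hx.1
    refine forall_congr' fun x => forall_congr' fun hx => forall₂_congr fun m _ => ?_
    refine iff_of_eq (congrArg (· ∈ Q) (funext fun j => ?_))
    refine Fin.cases rfl (fun j => Fin.cases ?_ (fun j => ?_) j) j
    · exact heq c hc x hx m
    · exact heq (cs j) (hcs j) x hx m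
  have hcode : ∀ c ∈ CCF ZFSet.omega.{u}, ∀ d ∈ CCF Θ.{u}, ∀ j,
      (Fin.cons d (Fin.cons c cs : Fin (n + 1) → ZFSet.{u}) : Fin (n + 2) → ZFSet.{u}) j ∈
        CCF Θ := fun c hc d hd j =>
    Fin.cases hd (fun j => CCF_mono omega_subset_Theta (Fin.cases hc hcs j)) j
  rw [Forces]
  constructor
  · rintro ⟨c, hc, d, hd, h⟩
    exact ⟨c, mem_Homega2_of_mem_CCF_omega hc, hc, d, mem_Homega2_of_mem_CCF_Theta hd, hd,
      (forall_isBranch_iff (hcode c hc d hd) hT Q).1 ((key c hc d hd).1 h)⟩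
  · rintro ⟨c, _, hc, d, _, hd, h⟩
    exact ⟨c, hc, d, hd, (key c hc d hd).2
      ((forall_isBranch_iff (hcode c hc d hd) hT Q).2 h)⟩

theorem Lev.forc_sigma2 {n : ℕ} {Q : Set (Fin (n + 2) → ZFSet.{u})} (hQ : D0 (fun w => w ∈ Q)) :
    Lev true 1 (fun v => v ∈ Forc (.sigma2 Q)) := by
  have h : Lev true 1 (fun v : Fin (n + 1) → ZFSet.{u} => ∃ c ∈ Homega2,
      c ∈ CCF ZFSet.omega.{u} ∧ ∃ d ∈ Homega2,
      d ∈ CCF Θ.{u} ∧ ∃ D ∈ Homega2, ∀ s ∈ v 0, ∀ m ∈ ZFSet.omega.{u},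
        (∃ j, ∃ i ∈ m, ¬ Decides ((Fin.cons d (Fin.cons c (fun i => v i.succ) :
          Fin (n + 1) → ZFSet.{u}) : Fin (n + 2) → ZFSet.{u}) j) s i) ∨
        ∃ w : Fin (n + 2) → ZFSet.{u}, (∀ j, w j ∈ D) ∧
          ((∀ j, IsDecided ((Fin.cons d (Fin.cons c (fun i => v i.succ) :
            Fin (n + 1) → ZFSet.{u}) : Fin (n + 2) → ZFSet.{u}) j) s m (w j)) ∧ w ∈ Q)) := by
    refine .ex (.and (.mem_CCF D0.mem_omega _ _) (.ex (.and (.mem_CCF D0.mem_Theta _ _)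
      (.ex (D0.lev_of ?_)))))
    let e : Fin (n + 2) → Tm.{u} (Option (Option (Option (Fin (n + 1))))) :=
      Fin.cons (.var (some none)) (Fin.cons (.var (some (some none)))
        fun i => .var (some (some (some i.succ))))
    refine (D0.forces_matrix hQ (.var (some (some (some 0)))) (.var none) e).congr fun v _ => ?_
    have he : ∀ j, (Fin.cons ((Tm.var none).ev fun i => v (some i))
        (Fin.cons ((Tm.var none).ev fun i => v (some (some i)))
          (fun i => v (some (some (some i.succ)))) : Fin (n + 1) → ZFSet.{u}) :
        Fin (n + 2) → ZFSet.{u}) j = (e j).ev v := fun j =>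
      Fin.cases rfl (fun j => Fin.cases rfl (fun j => rfl) j) j
    simp only [he]
    rfl
  refine ((Lev.isForcArgs true n).and h).congr fun v _ => ?_
  rw [mem_Forc_iff]
  exact and_congr_right fun hv => (forces_sigma2_iff hv.1 hv.2).symm

theorem forces_pi_iff {k n : ℕ} (φ : LFormula.{u} false k n) (T : ZFSet.{u})
    (cs : Fin n → ZFSet.{u}) :
    Forces φ T cs ↔ ¬ ∃ S ∈ WT.{u}, S ⊆ T ∧ Forces φ.dual S cs := by
  cases φ <;> rw [Forces]

/-- The quantifier over `S` is absorbed by the `Σ` class before negation, so the level does not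
rise; membership in `Forc φ.dual` already says that `S` is a wide tree. The conditions on the
arguments stand outside the negation and are used in their `Π_1` form. -/
theorem Lev.forc_pi {k n : ℕ} {φ : LFormula.{u} false (k + 2) n}
    (h : Lev true (k + 1) (fun v => v ∈ Forc φ.dual)) :
    Lev false (k + 1) (fun v => v ∈ Forc φ) := by
  have h1 : Lev true (k + 1) (fun v : Fin (n + 1) → ZFSet.{u} => ∃ S ∈ Homega2, S ⊆ v 0 ∧
      (Fin.cons S (fun i : Fin n => v i.succ) : Fin (n + 1) → ZFSet.{u}) ∈ Forc φ.dual) := by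
    refine .ex (.and (D0.subset (.var none) (.var (some 0))).lev_of ?_)
    refine (h.comp (fun j : Fin (n + 1) => (Fin.cases none (fun i => some i.succ) j :
      Option (Fin (n + 1))))).congr fun v _ => ?_
    refine iff_of_eq (congrArg (· ∈ Forc φ.dual) (funext fun j => ?_))
    exact Fin.cases rfl (fun j => rfl) j
  refine (((Lev.isForcArgs false n).mono (Nat.le_add_left 1 k)).and h1.not).congr fun v _ => ?_
  rw [mem_Forc_iff, forces_pi_iff]
  refine and_congr_right fun hv => not_congr ⟨?_, ?_⟩
  · rintro ⟨S, _, hST, hS, _, hF⟩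
    exact ⟨S, hS, hST, hF⟩
  · rintro ⟨S, hS, hST, hF⟩
    exact ⟨S, mem_Homega2_of_mem_WT hS, hST, hS, hv.2, hF⟩

/-- Here the level rises by one. The conditions on `v` and on the witness `c` are all contained in
membership in `Forc ψ`. -/
theorem Lev.forc_ex {k n : ℕ} {ψ : LFormula.{u} false k (n + 1)} {l : ℕ}
    (h : Lev false l (fun v => v ∈ Forc ψ)) :
    Lev true (l + 1) (fun v => v ∈ Forc (.ex ψ)) := by
  have h1 : Lev true (l + 1) (fun v : Fin (n + 1) → ZFSet.{u} => ∃ c ∈ Homega2,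
      (Fin.cons (v 0) (Fin.cons c (fun i : Fin n => v i.succ) : Fin (n + 1) → ZFSet.{u}) :
        Fin (n + 2) → ZFSet.{u}) ∈ Forc ψ) := by
    refine .ex ?_
    refine (h.succ_not.comp (fun j : Fin (n + 2) => (Fin.cases (some 0)
      (fun j => Fin.cases none (fun i => some i.succ) j) j : Option (Fin (n + 1))))).congr
        fun v _ => ?_
    refine iff_of_eq (congrArg (· ∈ Forc ψ) (funext fun j => ?_))
    exact Fin.cases rfl (fun j => Fin.cases rfl (fun j => rfl) j) j
  refine h1.congr fun v _ => ?_
  rw [mem_Forc_iff, Forces]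
  constructor
  · rintro ⟨c, _, hT, hcs, hF⟩
    exact ⟨⟨hT, fun i => hcs i.succ⟩, c, hcs 0, hF⟩
  · rintro ⟨⟨hT, hcs⟩, c, hc, hF⟩
    exact ⟨c, mem_Homega2_of_mem_CCF_omega hc, hT, fun i => Fin.cases hc hcs i, hF⟩

/-- At each `k` the `Σ` half comes first, from the `Π` half one step below or from the base case;
the `Π` half follows from it through the dual formula. -/
theorem Lev.forc (k : ℕ) :
    (∀ n (φ : LFormula.{u} true k n), φ.IsLegal → Lev true (k - 1) (fun v => v ∈ Forc φ)) ∧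
    ∀ n (φ : LFormula.{u} false k n), φ.IsLegal → Lev false (k - 1) (fun v => v ∈ Forc φ) := by
  induction k with
  | zero => exact ⟨fun n φ => absurd φ.two_le (by omega), fun n φ => absurd φ.two_le (by omega)⟩
  | succ k ih =>
    have hsigma : ∀ n (φ : LFormula.{u} true (k + 1) n), φ.IsLegal →
        Lev true k (fun v => v ∈ Forc φ) := by
      intro n φ hφ
      cases φ with
      | sigma2 Q => exact Lev.forc_sigma2 (D0.of_isSigma_zero hφ.2)
      | ex ψ =>
        have hk := ψ.two_le
        obtain ⟨l, rfl⟩ : ∃ l, k = l + 1 := ⟨k - 1, by omega⟩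
        exact Lev.forc_ex (ih.2 _ ψ hφ)
    refine ⟨hsigma, fun n φ hφ => ?_⟩
    have hk := φ.two_le
    obtain ⟨l, rfl⟩ : ∃ l, k = l + 1 := ⟨k - 1, by omega⟩
    exact Lev.forc_pi (hsigma n φ.dual hφ.dual)

theorem mem_Homega2_of_mem_Forc {b : Bool} {k n : ℕ} {φ : LFormula.{u} b k n}
    (v : Fin (n + 1) → ZFSet.{u}) (hv : v ∈ Forc φ) (i : Fin (n + 1)) : v i ∈ Homega2 :=
  (mem_Forc_iff.1 hv).1.mem_Homega2 i

end WideTrees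

/-- The hypothesis `V = L` is not used: whether a string decides a value is a property of the string
alone, so infinite sequences enter only through the well-foundedness of the strings that decide
nothing, which is both `Σ_1` and `Π_1` over `H_{ω_2}` even if the continuum is large. -/
theorem theorem15p3 (hVL : WideTrees.VEqualsL.{u}) (k : ℕ) (hk : 2 ≤ k) (n : ℕ) :
    (∀ φ : WideTrees.LFormula.{u} true k n, φ.IsLegal →
      WideTrees.IsSigma WideTrees.Homega2 (k - 1) (WideTrees.Forc φ)) ∧
    (∀ φ : WideTrees.LFormula.{u} false k n, φ.IsLegal →
      WideTrees.IsPi WideTrees.Homega2 (k - 1) (WideTrees.Forc φ)) :=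
  ⟨fun φ hφ => ((WideTrees.Lev.forc k).1 n φ hφ).exists_formula WideTrees.mem_Homega2_of_mem_Forc,
    fun φ hφ => ((WideTrees.Lev.forc k).2 n φ hφ).exists_formula WideTrees.mem_Homega2_of_mem_Forc⟩
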